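/- Let $m,n_1,n_2$ be integers with $n_1,n_2\ge m\ge 1$ and let $\Sigma_2$ be a real symmetric positive definite $m\times m$ matrix. For a positive definite $\Sigma$ let $W_m(n,\Sigma)$ denote the central Wishart distribution with $n$ degrees of freedom and covariance matrix $\Sigma$, i.e. the law of $\sum_{k=1}^n x_kx_k^{\top}$ with $x_1,\dots,x_n$ independent $N_m(0,\Sigma)$ random vectors. Let $W_1\sim W_m(n_1,I_m)$ and $W_2\sim W_m(n_2,\Sigma_2)$ be independent and put $U=W_2^{-1/2}W_1W_2^{-1/2}$, where $W_2^{1/2}$ is the positive definite square root of $W_2$ (which is almost surely positive definite) and $W_2^{-1/2}=(W_2^{1/2})^{-1}$. Then the law of $U$ has, with respect to the Lebesgue measure $dU=\prod_{i\le j}du_{ij}$ on real symmetric $m\times m$ matrices, the density $$f(U)=\frac{\Gamma_m\!\left(\frac{n_1+n_2}{2}\right)|\Sigma_2|^{n_1/2}}{\Gamma_m\!\left(\frac{n_1}{2}\right)\Gamma_m\!\left(\frac{n_2}{2}\right)}\,|I_m+\Sigma_2U|^{-(n_1+n_2)/2}\,|U|^{(n_1-m-1)/2}$$ for positive definite $U$,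 and $f(U)=0$ otherwise. Here $|\cdot|$ is the determinant and $\Gamma_m(a)=\pi^{m(m-1)/4}\prod_{i=1}^m\Gamma\!\left(a-\frac{i-1}{2}\right)$ is the multivariate gamma function. -/

import Mathlib

open MeasureTheory ProbabilityTheory
open scoped ENNReal MatrixOrder

noncomputable section

/-- The entrywise (product) sigma-algebra on real square matrices. -/
instance matrixMeasurableSpace (m : ℕ) : MeasurableSpace (Matrix (Fin m) (Fin m) ℝ) :=
  inferInstanceAs (MeasurableSpace (Fin m → Fin m → ℝ))

/-- It is the Borel sigma-algebra. -/
instance matrixBorelSpace (m : ℕ) : BorelSpace (Matrix (Fin m) (Fin m) ℝ) :=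
  inferInstanceAs (BorelSpace (Fin m → Fin m → ℝ))

/-- The symmetric `m × m` matrix with prescribed entries on and above the diagonal. -/
def symmOfUpper (m : ℕ) (x : {p : Fin m × Fin m // p.1 ≤ p.2} → ℝ) :
    Matrix (Fin m) (Fin m) ℝ :=
  Matrix.of fun i j => x ⟨(min i j, max i j), min_le_max⟩

theorem measurable_symmOfUpper (m : ℕ) : Measurable (symmOfUpper m) := by
  refine measurable_pi_lambda _ fun i => measurable_pi_lambda _ fun j => ?_
  exact measurable_pi_apply _

/-- Lebesgue measure `dU = ∏_{i ≤ j} du_ij` on symmetric `m × m` matrices, as a measure on all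
`m × m` matrices that is carried by the symmetric ones. -/
def symmVolume (m : ℕ) : Measure (Matrix (Fin m) (Fin m) ℝ) :=
  (volume : Measure ({p : Fin m × Fin m // p.1 ≤ p.2} → ℝ)).map (symmOfUpper m)

/-- The scatter matrix `∑ₖ xₖ xₖᵀ` of `n` vectors in `ℝᵐ`. -/
def scatterMatrix (m n : ℕ) (X : Fin n → EuclideanSpace ℝ (Fin m)) :
    Matrix (Fin m) (Fin m) ℝ :=
  ∑ k, Matrix.vecMulVec (X k) (X k)

theorem measurable_scatterMatrix (m n : ℕ) : Measurable (scatterMatrix m n) := by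
  refine measurable_pi_lambda _ fun i => measurable_pi_lambda _ fun j => ?_
  simp only [scatterMatrix, Matrix.sum_apply, Matrix.vecMulVec_apply]
  fun_prop

/-- The central Wishart distribution `W_m(n, S)` with `n` degrees of freedom and covariance
matrix `S`: the law of `∑ₖ xₖ xₖᵀ` for `n` independent `N_m(0, S)` vectors `xₖ`. -/
def wishart (m n : ℕ) (S : Matrix (Fin m) (Fin m) ℝ) : Measure (Matrix (Fin m) (Fin m) ℝ) :=
  (Measure.pi fun _ : Fin n => multivariateGaussian 0 S).map (scatterMatrix m n)

/-- The multivariate gamma function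
`Γ_m(a) = π^{m(m-1)/4} ∏_{i=1}^m Γ(a - (i-1)/2)`, used for `a > (m-1)/2`. -/
def multiGamma (m : ℕ) (a : ℝ) : ℝ :=
  Real.pi ^ ((m : ℝ) * ((m : ℝ) - 1) / 4) * ∏ i : Fin m, Real.Gamma (a - (i : ℝ) / 2)

end

/-! The engine is the image of Lebesgue measure on `n`-tuples of vectors in `ℝᵐ` under `X ↦ ∑
xₖxₖᵀ`. For `m ≤ n` it has density `gramConst m n * |W|^((n-m-1)/2)` on positive definite `W`
(`lintegral_scatterMatrix`). Transposing the data turns the scatter matrix into the Gram matrix of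
`m` vectors in `ℝⁿ`, and `lintegral_gram` goes by induction on `m`. Appending a vector `x` borders
the Gram matrix `G` by the inner products `b` and the corner `‖x‖²`. The part of `x` in the span
contributes `|G|^(-1/2) db`. The part orthogonal to it has squared norm equal to the Schur
complement `r`, and polar coordinates give it the density `r^(d/2-1)` up to a constant, with `d = n
- m`. Since the bordered determinant is `|G| r`, the powers combine.

Changes of variables are made on vectors, where `X ↦ AX` has Jacobian `|det A|^n`, so the Jacobian
of `W ↦ AWAᵀ` on symmetric matrices is never computed (`lintegral_scatterMatrix_congruence`).

Write `p = n₁`, `q = n₂`, `S = Σ₂`. Given `W₂ = W`, the matrix `U` is distributed as a scatter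
matrix of `p` vectors with weight proportional to `|W|^(p/2) exp(-tr(WU)/2)`. Integrating `W` out
against its own weight `exp(-tr(S⁻¹W)/2)` leaves the Gaussian moment of `|W|^(p/2)` with precision
`S⁻¹ + U`, which is a multiple of `|S⁻¹ + U|^(-(p+q)/2)`. Its constant comes from the total mass one
of the Wishart law with `p + q` degrees of freedom (`lintegral_exp_trace_mul_det_rpow`). Finally
`|S⁻¹ + U| = |S|⁻¹ |I + SU|`. -/

/-! ### Polar coordinates and product measures. -/

open Set in
/-- Integration of a function of the squared norm on Euclidean space. -/
theorem lintegral_comp_norm_sq {d : ℕ} (hd : 0 < d) {h : ℝ → ℝ≥0∞} (hh : Measurable h) :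
    ∫⁻ w : EuclideanSpace ℝ (Fin d), h (‖w‖ ^ 2) =
      ENNReal.ofReal (Real.pi ^ ((d : ℝ) / 2) / Real.Gamma ((d : ℝ) / 2)) *
        ∫⁻ r in Ioi (0 : ℝ), ENNReal.ofReal (r ^ ((d : ℝ) / 2 - 1)) * h r := by
  have : Nonempty (Fin d) := ⟨⟨0, hd⟩⟩
  set E := EuclideanSpace ℝ (Fin d)
  have hfin : Module.finrank ℝ E = d := by simp [E]
  have : Nontrivial E := Module.nontrivial_of_finrank_pos (R := ℝ) (by omega)
  have h1 : ∫⁻ w : E, h (‖w‖ ^ 2) =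
      (volume : Measure E).toSphere univ * ∫⁻ y : Ioi (0 : ℝ), h (y.1 ^ 2) ∂.volumeIoiPow (d - 1) := by
    -- Polar coordinates live on the punctured space; the origin is a null set because `0 < d`.
    conv_lhs => rw [← restrict_compl_singleton (μ := (volume : Measure E)) 0,
      ← lintegral_subtype_comap (measurableSet_singleton _).compl]
    have := (volume : Measure E).measurePreserving_homeomorphUnitSphereProd.lintegral_comp_emb
      (Homeomorph.measurableEmbedding _) (fun x => h (x.2.1 ^ 2))
    simp only [homeomorphUnitSphereProd_apply_snd_coe] at this
    rw [this, lintegral_prod _ (by fun_prop)]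
    simp only [lintegral_const, hfin, mul_comm]
  have h2 : ∫⁻ y : Ioi (0 : ℝ), h (y.1 ^ 2) ∂.volumeIoiPow (d - 1) =
      ∫⁻ y in Ioi (0 : ℝ), ENNReal.ofReal (y ^ (d - 1)) * h (y ^ 2) := by
    rw [Measure.volumeIoiPow, lintegral_withDensity_eq_lintegral_mul _ (by fun_prop) (by fun_prop)]
    exact lintegral_subtype_comap measurableSet_Ioi
      (fun y => ENNReal.ofReal (y ^ (d - 1)) * h (y ^ 2))
  have h3 : ∫⁻ r in Ioi (0 : ℝ), ENNReal.ofReal (r ^ ((d : ℝ) / 2 - 1)) * h r =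
      2 * ∫⁻ y in Ioi (0 : ℝ), ENNReal.ofReal (y ^ (d - 1)) * h (y ^ 2) := by
    -- Substitution `r = y²`, `dr = 2y dy`, which produces the factor `2`.
    have himg : (fun y : ℝ => y ^ 2) '' Ioi 0 = Ioi 0 := by
      ext r
      simp only [mem_image, mem_Ioi]
      exact ⟨by rintro ⟨y, hy, rfl⟩; positivity,
        fun hr => ⟨√r, Real.sqrt_pos.2 hr, Real.sq_sqrt hr.le⟩⟩
    have := lintegral_image_eq_lintegral_abs_deriv_mul (s := Ioi (0 : ℝ)) (f := fun y => y ^ 2)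
      (f' := fun y => 2 * y) measurableSet_Ioi
      (fun x _ => by simpa using (hasDerivAt_pow 2 x).hasDerivWithinAt)
      (fun x hx y hy hxy => by
        rw [mem_Ioi] at hx hy
        exact (pow_left_inj₀ hx.le hy.le two_ne_zero).1 hxy)
      (fun r => ENNReal.ofReal (r ^ ((d : ℝ) / 2 - 1)) * h r)
    rw [himg] at this
    rw [this, ← lintegral_const_mul _ (by fun_prop)]
    refine setLIntegral_congr_fun measurableSet_Ioi fun y (hy : 0 < y) => ?_
    rw [← mul_assoc, ← mul_assoc, ← ENNReal.ofReal_mul (abs_nonneg _)]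
    congr 1
    rw [← ENNReal.ofReal_ofNat 2, ← ENNReal.ofReal_mul (by norm_num), abs_of_pos (by positivity),
      ← Real.rpow_natCast y 2, ← Real.rpow_mul hy.le, ← Real.rpow_natCast y (d - 1), mul_assoc]
    congr 2
    nth_rw 1 [← Real.rpow_one y]
    rw [← Real.rpow_add hy]
    congr 1
    push_cast [Nat.cast_sub hd]
    ring
  rw [h1, h2, h3, Measure.toSphere_apply_univ, EuclideanSpace.volume_ball, hfin, ← mul_assoc (ENNReal.ofReal _) 2]
  congr 1
  have hd' : (0 : ℝ) < d := by exact_mod_cast hd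
  rw [← ENNReal.ofReal_ofNat 2, ← ENNReal.ofReal_mul
    (div_nonneg (by positivity) (Real.Gamma_pos_of_pos (by positivity)).le), ENNReal.ofReal_one,
    one_pow, one_mul, Fintype.card_fin, ← ENNReal.ofReal_natCast, ← ENNReal.ofReal_mul (by positivity)]
  congr 1
  -- The sphere has area `d` times the volume of the ball, and `Γ(d/2 + 1) = (d/2) Γ(d/2)` cancels
  -- `d`, leaving the `2` from the substitution.
  rw [Real.Gamma_add_one (by positivity), Real.sqrt_eq_rpow, ← Real.rpow_natCast,
    ← Real.rpow_mul Real.pi_pos.le]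
  have := (Real.Gamma_pos_of_pos (show (0 : ℝ) < d / 2 by positivity)).ne'
  rw [show 1 / 2 * (d : ℝ) = d / 2 by ring]
  field_simp

/-- Tonelli's theorem for a product of functions of the separate coordinates. -/
theorem lintegral_fin_prod_eq_prod {α : Type*} [MeasurableSpace α] {n : ℕ}
    (μ : Fin n → Measure α) [∀ i, SigmaFinite (μ i)] {f : Fin n → α → ℝ≥0∞}
    (hf : ∀ i, Measurable (f i)) :
    ∫⁻ x, ∏ i, f i (x i) ∂Measure.pi μ = ∏ i, ∫⁻ a, f i a ∂μ i := by
  induction n with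
  | zero => simp
  | succ n ih =>
    have hm : Measurable fun x : Fin (n + 1) → α => ∏ i, f i (x i) :=
      Finset.measurable_fun_prod _ fun i _ => (hf i).comp (measurable_pi_apply i)
    rw [← ((measurePreserving_piFinSuccAbove μ 0).symm _).lintegral_comp hm,
      lintegral_prod _ (by
        exact (hm.comp (MeasurableEquiv.piFinSuccAbove (fun _ => α) 0).symm.measurable).aemeasurable)]
    simp only [Fin.prod_univ_succ, MeasurableEquiv.piFinSuccAbove_symm_apply,
      Fin.insertNthEquiv_zero, Fin.consEquiv_apply, Fin.cons_zero, Fin.cons_succ]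
    rw [← ih (fun i => μ i.succ) fun i => hf i.succ, ← lintegral_mul_const _ (hf 0)]
    refine lintegral_congr fun a => ?_
    rw [lintegral_const_mul _
      (Finset.measurable_fun_prod _ fun i _ => (hf i.succ).comp (measurable_pi_apply i))]
    rfl

/-- A finite power of a measure with a density has the product density. -/
theorem pi_withDensity {α : Type*} [MeasurableSpace α] (n : ℕ) (μ : Measure α) [SigmaFinite μ]
    {f : α → ℝ≥0∞} (hf : Measurable f) [SigmaFinite (μ.withDensity f)] :
    Measure.pi (fun _ : Fin n => μ.withDensity f) =
      (Measure.pi fun _ : Fin n => μ).withDensity fun x => ∏ i, f (x i) := by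
  refine Measure.pi_eq fun s hs => ?_
  rw [withDensity_apply _ (MeasurableSet.univ_pi hs), Measure.restrict_pi_pi,
    lintegral_fin_prod_eq_prod _ fun _ => hf]
  exact Finset.prod_congr rfl fun i _ => (withDensity_apply _ (hs i)).symm

/-- Uncurrying a finite array of real numbers preserves Lebesgue measure. -/
theorem measurePreserving_curry_symm (ι κ : Type*) [Fintype ι] [Fintype κ] :
    MeasurePreserving (MeasurableEquiv.curry ι κ ℝ).symm := by
  refine ⟨MeasurableEquiv.measurable _, (Measure.pi_eq fun s hs => ?_).symm⟩
  rw [Measure.map_apply (MeasurableEquiv.measurable _) (MeasurableSet.univ_pi hs),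
    show (MeasurableEquiv.curry ι κ ℝ).symm ⁻¹' Set.univ.pi s =
      Set.univ.pi fun i => Set.univ.pi fun k => s (i, k) by ext x; simp [Set.mem_pi]]
  simp_rw [volume_pi, Measure.pi_pi, Fintype.prod_prod_type]

/-- Exchanging the indices of a finite array of real numbers preserves Lebesgue measure. -/
theorem measurePreserving_swap_pi (ι κ : Type*) [Fintype ι] [Fintype κ] :
    MeasurePreserving (fun (x : ι → κ → ℝ) k i => x i k) := by
  have hs : MeasurePreserving (fun (x : ι → κ → ℝ) (p : κ × ι) => x p.2 p.1) := by
    refine ⟨by fun_prop, (Measure.pi_eq fun s hs => ?_).symm⟩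
    rw [Measure.map_apply (by fun_prop) (MeasurableSet.univ_pi hs),
      show (fun (x : ι → κ → ℝ) (p : κ × ι) => x p.2 p.1) ⁻¹' Set.univ.pi s =
        Set.univ.pi fun i => Set.univ.pi fun k => s (k, i) by
          ext x; simpa [Set.mem_pi] using forall_comm]
    simp_rw [volume_pi, Measure.pi_pi, Fintype.prod_prod_type]
    exact Finset.prod_comm
  exact ((measurePreserving_curry_symm κ ι).symm _).comp hs

/-! ### Measurability of matrix operations and of the positive definite cone. -/

theorem measurable_det {m : ℕ} :
    Measurable (Matrix.det : Matrix (Fin m) (Fin m) ℝ → ℝ) :=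
  (Continuous.matrix_det continuous_id).measurable

theorem measurable_matrix_mul {m : ℕ} {α : Type*} [MeasurableSpace α]
    {f g : α → Matrix (Fin m) (Fin m) ℝ} (hf : Measurable f) (hg : Measurable g) :
    Measurable fun a => f a * g a := by
  have h2 : Measurable fun p : Matrix (Fin m) (Fin m) ℝ × Matrix (Fin m) (Fin m) ℝ => p.1 * p.2 := by
    refine measurable_pi_lambda _ fun i => measurable_pi_lambda _ fun j => ?_
    simp only [Matrix.mul_apply]
    refine Finset.measurable_sum _ fun k _ => Measurable.mul ?_ ?_
    · exact (measurable_pi_apply k).comp ((measurable_pi_apply i).comp measurable_fst)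
    · exact (measurable_pi_apply j).comp ((measurable_pi_apply k).comp measurable_snd)
  exact h2.comp (hf.prodMk hg)

theorem measurable_matrix_inv {m : ℕ} :
    Measurable (fun A : Matrix (Fin m) (Fin m) ℝ => A⁻¹) := by
  have hadj : Measurable (fun A : Matrix (Fin m) (Fin m) ℝ => A.adjugate) :=
    (Continuous.matrix_adjugate continuous_id).measurable
  refine measurable_pi_lambda _ fun i => measurable_pi_lambda _ fun j => ?_
  simp only [Matrix.inv_def, Ring.inverse_eq_inv', Matrix.smul_apply, smul_eq_mul]
  exact measurable_det.inv.mul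
    ((measurable_pi_apply j).comp ((measurable_pi_apply i).comp hadj))

theorem isClosed_posSemidef (m : ℕ) :
    IsClosed {A : Matrix (Fin m) (Fin m) ℝ | A.PosSemidef} := by
  simp only [Matrix.posSemidef_iff_dotProduct_mulVec, Set.ofPred_and, Set.ofPred_forall]
  refine IsClosed.inter ?_ (isClosed_iInter fun x => ?_)
  · exact isClosed_eq (by fun_prop) continuous_id
  · exact isClosed_le continuous_const (by fun_prop)

theorem measurableSet_posDef (m : ℕ) :
    MeasurableSet {A : Matrix (Fin m) (Fin m) ℝ | A.PosDef} := by
  have : {A : Matrix (Fin m) (Fin m) ℝ | A.PosDef} =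
      {A | A.PosSemidef} ∩ Matrix.det ⁻¹' {0}ᶜ := by
    ext A
    exact ⟨fun h => ⟨h.posSemidef, h.det_pos.ne'⟩, fun h => h.1.posDef_iff_det_ne_zero.2 h.2⟩
  rw [this]
  exact (isClosed_posSemidef m).measurableSet.inter
    (measurable_det (measurableSet_singleton _).compl)

open Matrix.Norms.L2Operator in
theorem continuousOn_matrix_sqrt (m : ℕ) :
    ContinuousOn (CFC.sqrt : Matrix (Fin m) (Fin m) ℝ → Matrix (Fin m) (Fin m) ℝ)
      {A | A.PosSemidef} := by
  simpa only [← Matrix.nonneg_iff_posSemidef] using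
    CFC.continuousOn_sqrt (A := Matrix (Fin m) (Fin m) ℝ)

/-- `CFC.sqrt` takes the default value `0` off the positive semidefinite matrices, so it is
continuous on a closed set and constant on the complement. -/
theorem measurable_matrix_sqrt (m : ℕ) :
    Measurable (CFC.sqrt : Matrix (Fin m) (Fin m) ℝ → Matrix (Fin m) (Fin m) ℝ) := by
  classical
  have h : (CFC.sqrt : Matrix (Fin m) (Fin m) ℝ → Matrix (Fin m) (Fin m) ℝ) =
      Set.piecewise {A | A.PosSemidef} CFC.sqrt fun _ => 0 := by
    ext1 A
    by_cases hA : A.PosSemidef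
    · simp [Set.piecewise, hA]
    · have h0 : ¬ 0 ≤ A := mt Matrix.nonneg_iff_posSemidef.1 hA
      simp [Set.piecewise, hA, CFC.sqrt_of_not_nonneg h0]
  rw [h]
  exact (continuousOn_matrix_sqrt m).measurable_piecewise continuousOn_const
    (isClosed_posSemidef m).measurableSet

/-! ### Splitting a vector along a span and its orthogonal complement. -/

open Set in
/-- The Lebesgue integral of a function of the inner products with `m` independent vectors and of
the squared norm. -/
theorem lintegral_inner_normSq {m d n : ℕ} (hd : 0 < d) (hn : n = m + d)
    (v : Fin m → EuclideanSpace ℝ (Fin n)) (hv : (Matrix.gram ℝ v).PosDef)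
    {g : (Fin m → ℝ) → ℝ → ℝ≥0∞} (hg : Measurable (Function.uncurry g)) :
    ∫⁻ x : EuclideanSpace ℝ (Fin n), g (fun i => inner ℝ (v i) x) (‖x‖ ^ 2) =
      ENNReal.ofReal (Real.pi ^ ((d : ℝ) / 2) / Real.Gamma ((d : ℝ) / 2) *
          (Matrix.gram ℝ v).det ^ (-(1 / 2) : ℝ)) *
        ∫⁻ b : Fin m → ℝ, ∫⁻ r in Ioi (0 : ℝ), ENNReal.ofReal (r ^ ((d : ℝ) / 2 - 1)) *
          g b (b ⬝ᵥ (Matrix.gram ℝ v)⁻¹.mulVec b + r) := by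
  set G := Matrix.gram ℝ v with hG
  have hli : LinearIndependent ℝ v := Matrix.linearIndependent_of_posDef_gram hv
  -- An orthonormal basis adapted to the span of `v`: the `Sum.inl` vectors span it and the `d`
  -- `Sum.inr` vectors are orthogonal to it.
  obtain ⟨e, he⟩ : ∃ e : OrthonormalBasis (Fin m ⊕ Fin d) ℝ (EuclideanSpace ℝ (Fin n)),
      ∀ i j, inner ℝ (e (Sum.inr j)) (v i) = 0 := by
    let s := Submodule.span ℝ (range v)
    have hs : Module.finrank ℝ s = m := by simpa using finrank_span_eq_card hli
    let b₀ : OrthonormalBasis (Fin m) ℝ s := (stdOrthonormalBasis ℝ s).reindex (finCongr hs)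
    have hon : Orthonormal ℝ ((range (Sum.inl : Fin m → Fin m ⊕ Fin d)).domRestrict
        (Sum.elim (fun i => (b₀ i : EuclideanSpace ℝ (Fin n))) fun _ => 0)) := by
      have h0 : Orthonormal ℝ fun i => (b₀ i : EuclideanSpace ℝ (Fin n)) :=
        b₀.orthonormal.comp_linearIsometry s.subtypeₗᵢ
      rw [orthonormal_iff_ite] at h0 ⊢
      rintro ⟨_, i, rfl⟩ ⟨_, j, rfl⟩
      simpa [Subtype.ext_iff] using h0 i j
    obtain ⟨e, he⟩ := hon.exists_orthonormalBasis_extension_of_card_eq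
      (by simp [hn])
    refine ⟨e, fun i j => ?_⟩
    have hvi : v i ∈ s := Submodule.subset_span (mem_range_self i)
    have : (v i : EuclideanSpace ℝ (Fin n)) = ∑ k, b₀.repr ⟨v i, hvi⟩ k • e (Sum.inl k) := by
      conv_lhs => rw [show v i = ((⟨v i, hvi⟩ : s) : EuclideanSpace ℝ (Fin n)) from rfl, ← b₀.sum_repr ⟨v i, hvi⟩]
      simp [he _ (mem_range_self _)]
    rw [this, inner_sum]
    refine Finset.sum_eq_zero fun k _ => ?_
    rw [inner_smul_right, e.orthonormal.2 (by simp), mul_zero]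
  -- `M` holds the coordinates of `v` in the basis of its span, so `M` is a square root of `G` in
  -- the sense `MMᵀ = G`, and `b = My` for the coordinates `y` of the projection of `x`.
  let M : Matrix (Fin m) (Fin m) ℝ := Matrix.of fun i j => inner ℝ (v i) (e (Sum.inl j))
  have hMG : M * M.transpose = G := by
    ext i j
    rw [Matrix.mul_apply, hG, Matrix.gram_apply, ← e.sum_inner_mul_inner, Fintype.sum_sum_type]
    simp [M, he, real_inner_comm]
  have hdet : M.det * M.det = G.det := by rw [← hMG, Matrix.det_mul, Matrix.det_transpose]
  have hM0 : M.det ≠ 0 := fun h => hv.det_pos.ne' (by rw [← hdet, h, zero_mul])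
  have hMu : IsUnit M.det := hM0.isUnit
  -- The Jacobian of `b = My`, and next the identity `bᵀG⁻¹b = ‖y‖²`; hence `r` is the squared
  -- distance of `x` from the span.
  have habs : |M.det⁻¹| = G.det ^ (-(1 / 2) : ℝ) := by
    rw [Real.rpow_neg hv.det_pos.le, ← Real.sqrt_eq_rpow, ← hdet, Real.sqrt_mul_self_eq_abs, abs_inv]
  have hquad (y : Fin m → ℝ) : M.mulVec y ⬝ᵥ G⁻¹.mulVec (M.mulVec y) = y ⬝ᵥ y := by
    rw [← hMG, Matrix.mul_inv_rev, Matrix.mulVec_mulVec, Matrix.mul_assoc,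
      Matrix.nonsing_inv_mul _ hMu, Matrix.mul_one, ← Matrix.vecMul_transpose,
      ← Matrix.dotProduct_mulVec, Matrix.mulVec_mulVec,
      Matrix.mul_nonsing_inv _ (by rwa [Matrix.det_transpose]), Matrix.one_mulVec]
  have hg' (b : Fin m → ℝ) : Measurable (g b) := hg.comp (measurable_const.prodMk measurable_id)
  let T : (Fin m ⊕ Fin d → ℝ) → EuclideanSpace ℝ (Fin n) := fun z => e.repr.symm (WithLp.toLp 2 z)
  have hT : MeasurePreserving T :=
    e.measurePreserving_repr_symm.comp (PiLp.volume_preserving_toLp _)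
  have hTi (z) (i : Fin m) : inner ℝ (v i) (T z) = M.mulVec (fun j => z (Sum.inl j)) i := by
    rw [← e.sum_inner_mul_inner, Fintype.sum_sum_type]
    simp only [T, Matrix.mulVec, dotProduct, M, Matrix.of_apply, real_inner_comm (e (Sum.inr _)),
      he, ← e.repr_apply_apply, LinearIsometryEquiv.apply_symm_apply]
    simp
  have hTn (z) : ‖T z‖ ^ 2 = (fun j => z (Sum.inl j)) ⬝ᵥ (fun j => z (Sum.inl j)) +
      ‖(WithLp.toLp 2 fun j => z (Sum.inr j) : EuclideanSpace ℝ (Fin d))‖ ^ 2 := by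
    simp only [T, LinearIsometryEquiv.norm_map, EuclideanSpace.norm_sq_eq, Fintype.sum_sum_type,
      Real.norm_eq_abs, sq_abs, dotProduct, ← sq]
  let F : (Fin m → ℝ) → ℝ≥0∞ := fun b =>
    ∫⁻ r in Ioi (0 : ℝ), ENNReal.ofReal (r ^ ((d : ℝ) / 2 - 1)) *
      g b (b ⬝ᵥ G⁻¹.mulVec b + r)
  have hcont : Continuous fun b : Fin m → ℝ => b ⬝ᵥ G⁻¹.mulVec b := by fun_prop
  have hF : Measurable F := by
    refine Measurable.lintegral_prod_right'
      (f := fun p : (Fin m → ℝ) × ℝ => ENNReal.ofReal (p.2 ^ ((d : ℝ) / 2 - 1)) *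
        g p.1 (p.1 ⬝ᵥ G⁻¹.mulVec p.1 + p.2)) ?_
    refine Measurable.mul (by fun_prop) (hg.comp (f := fun p : (Fin m → ℝ) × ℝ =>
      (p.1, p.1 ⬝ᵥ G⁻¹.mulVec p.1 + p.2)) (measurable_fst.prodMk ?_))
    exact (hcont.measurable.comp measurable_fst).add measurable_snd
  have hmeas : Measurable fun x : EuclideanSpace ℝ (Fin n) => g (fun i => inner ℝ (v i) x) (‖x‖ ^ 2) :=
    hg.comp (Measurable.prodMk (by fun_prop) (by fun_prop))
  have hmeas2 : Measurable fun p : (Fin m → ℝ) × (Fin d → ℝ) => g (M.mulVec p.1)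
      (p.1 ⬝ᵥ p.1 + ‖(WithLp.toLp 2 p.2 : EuclideanSpace ℝ (Fin d))‖ ^ 2) := by
    refine hg.comp (Measurable.prodMk ?_ (Measurable.add ?_ (by fun_prop)))
    · exact (Continuous.measurable (f := M.mulVec) (by fun_prop)).comp measurable_fst
    · exact (Continuous.measurable (f := fun y : Fin m → ℝ => y ⬝ᵥ y) (by fun_prop)).comp
        measurable_fst
  calc ∫⁻ x : EuclideanSpace ℝ (Fin n), g (fun i => inner ℝ (v i) x) (‖x‖ ^ 2)
      = ∫⁻ z : Fin m ⊕ Fin d → ℝ, g (fun i => inner ℝ (v i) (T z)) (‖T z‖ ^ 2) :=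
        (hT.lintegral_comp hmeas).symm
    _ = ∫⁻ p : (Fin m → ℝ) × (Fin d → ℝ), g (M.mulVec p.1)
          (p.1 ⬝ᵥ p.1 + ‖(WithLp.toLp 2 p.2 : EuclideanSpace ℝ (Fin d))‖ ^ 2) := by
        rw [← (volume_measurePreserving_sumPiEquivProdPi fun _ => ℝ).lintegral_comp hmeas2]
        refine lintegral_congr fun z => ?_
        rw [hTn, funext (hTi z)]
        rfl
    _ = ∫⁻ y : Fin m → ℝ, ∫⁻ w : EuclideanSpace ℝ (Fin d),
          g (M.mulVec y) (y ⬝ᵥ y + ‖w‖ ^ 2) := by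
        rw [Measure.volume_eq_prod, lintegral_prod _ hmeas2.aemeasurable]
        refine lintegral_congr fun y => ?_
        exact (PiLp.volume_preserving_toLp (Fin d)).lintegral_comp
          (f := fun w => g (M.mulVec y) (y ⬝ᵥ y + ‖w‖ ^ 2))
          ((hg' _).comp (by fun_prop))
    _ = ∫⁻ y : Fin m → ℝ, ENNReal.ofReal (Real.pi ^ ((d : ℝ) / 2) / Real.Gamma ((d : ℝ) / 2)) *
          F (Matrix.toLin' M y) := by
        refine lintegral_congr fun y => ?_
        rw [lintegral_comp_norm_sq hd (h := fun r => g (M.mulVec y) (y ⬝ᵥ y + r))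
          ((hg' _).comp (by fun_prop))]
        simp only [F, Matrix.toLin'_apply, hquad]
    _ = _ := by
        have hML : Measurable (Matrix.toLin' M) :=
          (LinearMap.continuous_of_finiteDimensional _).measurable
        rw [lintegral_const_mul (f := fun y => F (Matrix.toLin' M y)) _ (hF.comp hML), ← lintegral_map hF hML,
          Real.map_matrix_volume_pi_eq_smul_volume_pi hM0, lintegral_smul_measure, habs,
          smul_eq_mul, ← mul_assoc, ← ENNReal.ofReal_mul]
        exact div_nonneg (by positivity) (Real.Gamma_nonneg_of_nonneg (by positivity))

/-! ### Bordered matrices and Schur complements. -/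

/-- The symmetric matrix obtained from `G` by appending the column and row `b` and the diagonal
entry `c`. -/
def borderedMatrix {m : ℕ} (G : Matrix (Fin m) (Fin m) ℝ) (b : Fin m → ℝ) (c : ℝ) :
    Matrix (Fin (m + 1)) (Fin (m + 1)) ℝ :=
  (Matrix.fromBlocks G (Matrix.replicateCol (Fin 1) b) (Matrix.replicateCol (Fin 1) b).conjTranspose
    (Matrix.of fun _ _ => c)).submatrix finSumFinEquiv.symm finSumFinEquiv.symm

section
variable {m : ℕ} (G : Matrix (Fin m) (Fin m) ℝ) (b : Fin m → ℝ) (c : ℝ)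

theorem borderedMatrix_castSucc_castSucc (i j : Fin m) :
    borderedMatrix G b c i.castSucc j.castSucc = G i j := by
  rw [borderedMatrix, show i.castSucc = Fin.castAdd 1 i from rfl,
    show j.castSucc = Fin.castAdd 1 j from rfl]
  simp

theorem borderedMatrix_castSucc_last (i : Fin m) :
    borderedMatrix G b c i.castSucc (Fin.last m) = b i := by
  rw [borderedMatrix, show i.castSucc = Fin.castAdd 1 i from rfl,
    show Fin.last m = Fin.natAdd m (0 : Fin 1) from rfl]
  simp

theorem borderedMatrix_last_castSucc (j : Fin m) :
    borderedMatrix G b c (Fin.last m) j.castSucc = b j := by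
  rw [borderedMatrix, show j.castSucc = Fin.castAdd 1 j from rfl,
    show Fin.last m = Fin.natAdd m (0 : Fin 1) from rfl]
  simp

theorem borderedMatrix_last_last : borderedMatrix G b c (Fin.last m) (Fin.last m) = c := by
  rw [borderedMatrix, show Fin.last m = Fin.natAdd m (0 : Fin 1) from rfl]
  simp

variable {G} in
theorem schurComplement_replicateCol :
    (Matrix.of fun _ _ => c : Matrix (Fin 1) (Fin 1) ℝ) -
      (Matrix.replicateCol (Fin 1) b).conjTranspose * G⁻¹ * Matrix.replicateCol (Fin 1) b =
      Matrix.of fun _ _ => c - b ⬝ᵥ G⁻¹.mulVec b := by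
  ext i j
  rw [Matrix.mul_assoc]
  simp [Matrix.mul_apply, dotProduct, Matrix.mulVec]

variable {G} in
theorem det_borderedMatrix (hG : G.PosDef) :
    (borderedMatrix G b c).det = G.det * (c - b ⬝ᵥ G⁻¹.mulVec b) := by
  have := hG.isUnit.invertible
  rw [borderedMatrix, Matrix.det_submatrix_equiv_self, Matrix.det_fromBlocks₁₁,
    Matrix.invOf_eq_nonsing_inv, schurComplement_replicateCol, Matrix.det_fin_one]
  rfl

/-- Given a positive definite corner block, positivity is that of the Schur complement, here a
scalar. In one direction it is the ratio of two positive determinants. -/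
theorem borderedMatrix_posDef_iff :
    (borderedMatrix G b c).PosDef ↔ G.PosDef ∧ 0 < c - b ⬝ᵥ G⁻¹.mulVec b := by
  constructor
  · intro h
    have hG : G.PosDef := by
      have := h.submatrix (Fin.castSucc_injective m)
      convert this using 1
      ext i j
      exact (borderedMatrix_castSucc_castSucc G b c i j).symm
    refine ⟨hG, ?_⟩
    have := h.det_pos
    rw [det_borderedMatrix b c hG] at this
    exact (mul_pos_iff_of_pos_left hG.det_pos).1 this
  · rintro ⟨hG, hc⟩
    have := hG.isUnit.invertible
    have hs : (borderedMatrix G b c).PosSemidef := by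
      rw [borderedMatrix, Matrix.posSemidef_submatrix_equiv, Matrix.PosDef.fromBlocks₁₁ _ _ hG,
        schurComplement_replicateCol,
        show (Matrix.of fun _ _ => c - b ⬝ᵥ G⁻¹.mulVec b : Matrix (Fin 1) (Fin 1) ℝ) =
          Matrix.diagonal fun _ => c - b ⬝ᵥ G⁻¹.mulVec b by
          ext i j; simp [Subsingleton.elim i j]]
      exact Matrix.PosSemidef.diagonal fun _ => hc.le
    rw [hs.posDef_iff_det_ne_zero, det_borderedMatrix b c hG]
    exact (mul_pos hG.det_pos hc).ne'

end

theorem measurable_borderedMatrix (m : ℕ) :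
    Measurable fun p : Matrix (Fin m) (Fin m) ℝ × (Fin m → ℝ) × ℝ =>
      borderedMatrix p.1 p.2.1 p.2.2 := by
  refine measurable_pi_lambda _ fun i => measurable_pi_lambda _ fun j => ?_
  refine Fin.lastCases ?_ (fun i => ?_) i <;> refine Fin.lastCases ?_ (fun j => ?_) j <;>
    simp only [borderedMatrix_castSucc_castSucc, borderedMatrix_castSucc_last,
      borderedMatrix_last_castSucc, borderedMatrix_last_last]
  · fun_prop
  · fun_prop
  · fun_prop
  · exact (measurable_pi_apply j).comp ((measurable_pi_apply i).comp measurable_fst)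

/-! ### Lebesgue measure on symmetric matrices, one row at a time. -/

/-- The positions on and above the diagonal of an `(m + 1) × (m + 1)` matrix. -/
noncomputable def upperSuccEquiv (m : ℕ) :
    {p : Fin m × Fin m // p.1 ≤ p.2} ⊕ (Fin m ⊕ Unit) ≃
      {p : Fin (m + 1) × Fin (m + 1) // p.1 ≤ p.2} :=
  Equiv.ofBijective
    (Sum.elim (fun p => ⟨(p.1.1.castSucc, p.1.2.castSucc), by simpa using p.2⟩)
      (Sum.elim (fun i => ⟨(i.castSucc, Fin.last m), Fin.le_last _⟩)
        fun _ => ⟨(Fin.last m, Fin.last m), le_rfl⟩)) <| by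
    constructor
    · rintro (⟨⟨i, j⟩, h⟩ | i | _) (⟨⟨i', j'⟩, h'⟩ | i' | _) <;>
        simp [(Fin.castSucc_lt_last _).ne, (Fin.castSucc_lt_last _).ne']
    · rintro ⟨⟨i, j⟩, h⟩
      induction j using Fin.lastCases with
      | last =>
        induction i using Fin.lastCases with
        | last => exact ⟨Sum.inr (Sum.inr ()), rfl⟩
        | cast i => exact ⟨Sum.inr (Sum.inl i), rfl⟩
      | cast j =>
        induction i using Fin.lastCases with
        | last => exact absurd h (not_le.2 (Fin.castSucc_lt_last j))
        | cast i => exact ⟨Sum.inl ⟨(i, j), by simpa using h⟩, rfl⟩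

theorem symmOfUpper_succ (m : ℕ) (x : {p : Fin (m + 1) × Fin (m + 1) // p.1 ≤ p.2} → ℝ) :
    symmOfUpper (m + 1) x =
      borderedMatrix (symmOfUpper m fun p => x (upperSuccEquiv m (Sum.inl p)))
        (fun i => x (upperSuccEquiv m (Sum.inr (Sum.inl i))))
        (x (upperSuccEquiv m (Sum.inr (Sum.inr ())))) := by
  ext i j
  refine Fin.lastCases ?_ (fun i => ?_) i <;> refine Fin.lastCases ?_ (fun j => ?_) j <;>
    simp only [borderedMatrix_castSucc_castSucc, borderedMatrix_castSucc_last,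
      borderedMatrix_last_castSucc, borderedMatrix_last_last] <;>
    simp only [symmOfUpper, upperSuccEquiv, Matrix.of_apply] <;> congr 2
  all_goals simp [Fin.le_last]

/-- The upper entries split along `upperSuccEquiv` into those of the leading block, the last column
and the corner, so the measure is a product of the three. -/
theorem lintegral_symmVolume_succ (m : ℕ)
    {F : Matrix (Fin (m + 1)) (Fin (m + 1)) ℝ → ℝ≥0∞} (hF : Measurable F) :
    ∫⁻ W, F W ∂symmVolume (m + 1) =
      ∫⁻ G, (∫⁻ b : Fin m → ℝ, ∫⁻ c : ℝ, F (borderedMatrix G b c)) ∂symmVolume m := by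
  have hB := hF.comp (measurable_borderedMatrix m)
  have hinner : Measurable fun p : Matrix (Fin m) (Fin m) ℝ × (Fin m → ℝ) =>
      ∫⁻ c : ℝ, F (borderedMatrix p.1 p.2 c) :=
    Measurable.lintegral_prod_right'
      (f := fun q : (Matrix (Fin m) (Fin m) ℝ × (Fin m → ℝ)) × ℝ =>
        F (borderedMatrix q.1.1 q.1.2 q.2))
      (hB.comp (f := fun q : (Matrix (Fin m) (Fin m) ℝ × (Fin m → ℝ)) × ℝ =>
        (q.1.1, q.1.2, q.2)) (by fun_prop))
  have houter : Measurable fun G : Matrix (Fin m) (Fin m) ℝ =>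
      ∫⁻ b : Fin m → ℝ, ∫⁻ c : ℝ, F (borderedMatrix G b c) := hinner.lintegral_prod_right'
  rw [symmVolume, lintegral_map hF (measurable_symmOfUpper _), symmVolume,
    lintegral_map houter (measurable_symmOfUpper _)]
  have h1 := (volume_measurePreserving_piCongrLeft (fun _ => ℝ) (upperSuccEquiv m)).symm
  have h2 := volume_measurePreserving_sumPiEquivProdPi
    fun _ : {p : Fin m × Fin m // p.1 ≤ p.2} ⊕ (Fin m ⊕ Unit) => ℝ
  have h3 := volume_measurePreserving_sumPiEquivProdPi fun _ : Fin m ⊕ Unit => ℝ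
  have h4 := volume_preserving_funUnique Unit ℝ
  have h5 := (((MeasurePreserving.id volume).prod
    (((MeasurePreserving.id volume).prod h4).comp h3)).comp h2).comp h1
  have h6 : Measurable fun q : ({p : Fin m × Fin m // p.1 ≤ p.2} → ℝ) × (Fin m → ℝ) × ℝ =>
      F (borderedMatrix (symmOfUpper m q.1) q.2.1 q.2.2) :=
    hB.comp (((measurable_symmOfUpper m).comp measurable_fst).prodMk measurable_snd)
  calc _ = ∫⁻ q : ({p : Fin m × Fin m // p.1 ≤ p.2} → ℝ) × (Fin m → ℝ) × ℝ,
        F (borderedMatrix (symmOfUpper m q.1) q.2.1 q.2.2) := by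
        rw [Measure.volume_eq_prod, Measure.volume_eq_prod, ← h5.lintegral_comp h6]
        refine lintegral_congr fun x => ?_
        rw [symmOfUpper_succ]
        rfl
    _ = _ := by
        rw [Measure.volume_eq_prod, lintegral_prod _ h6.aemeasurable]
        refine lintegral_congr fun y => ?_
        rw [Measure.volume_eq_prod, lintegral_prod]
        exact (h6.comp measurable_prodMk_left).aemeasurable

/-! ### The constants: multivariate gamma function and `gramConst`. -/

theorem multiGamma_pos {m : ℕ} {a : ℝ} (h : ((m : ℝ) - 1) / 2 < a) : 0 < multiGamma m a := by
  refine mul_pos (by positivity) (Finset.prod_pos fun i _ => Real.Gamma_pos_of_pos ?_)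
  have : ((i : ℕ) : ℝ) + 1 ≤ m := by exact_mod_cast i.2
  linarith

theorem multiGamma_natCast_pos {m n : ℕ} (h : m ≤ n) : 0 < multiGamma m ((n : ℝ) / 2) := by
  refine multiGamma_pos ?_
  have : (m : ℝ) ≤ n := by exact_mod_cast h
  linarith

theorem multiGamma_succ (m : ℕ) (a : ℝ) :
    multiGamma (m + 1) a = multiGamma m a * (Real.pi ^ ((m : ℝ) / 2) * Real.Gamma (a - m / 2)) := by
  rw [multiGamma, multiGamma, Fin.prod_univ_castSucc,
    show ((m + 1 : ℕ) : ℝ) * (((m + 1 : ℕ) : ℝ) - 1) / 4 = (m : ℝ) * (m - 1) / 4 + m / 2 by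
      push_cast; ring, Real.rpow_add Real.pi_pos]
  simp only [Fin.val_castSucc, Fin.val_last]
  ring

/-- The constant in the image of Lebesgue measure under the Gram matrix. -/
noncomputable def gramConst (m n : ℕ) : ℝ :=
  Real.pi ^ ((m : ℝ) * n / 2) / multiGamma m ((n : ℝ) / 2)

theorem gramConst_pos {m n : ℕ} (h : m ≤ n) : 0 < gramConst m n :=
  div_pos (by positivity) (multiGamma_natCast_pos h)

/-- The new factor is the constant of `lintegral_comp_norm_sq` in dimension `d`, that of the
complement of `m` independent vectors in `ℝ^(m+d)`. -/
theorem gramConst_succ (m d : ℕ) :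
    gramConst (m + 1) (m + d) = gramConst m (m + d) *
      (Real.pi ^ ((d : ℝ) / 2) / Real.Gamma ((d : ℝ) / 2)) := by
  rw [gramConst, gramConst, multiGamma_succ, show ((m + d : ℕ) : ℝ) / 2 - m / 2 = d / 2 by
    push_cast; ring, show ((m + 1 : ℕ) : ℝ) * ((m + d : ℕ) : ℝ) / 2 =
      (m : ℝ) * ((m + d : ℕ) : ℝ) / 2 + (d / 2 + m / 2) by push_cast; ring,
    Real.rpow_add Real.pi_pos, Real.rpow_add Real.pi_pos]
  have : Real.pi ^ ((m : ℝ) / 2) ≠ 0 := by positivity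
  field_simp

/-! ### The image of Lebesgue measure under the Gram matrix. -/

theorem gram_snoc {m n : ℕ} (v : Fin m → EuclideanSpace ℝ (Fin n)) (x : EuclideanSpace ℝ (Fin n)) :
    Matrix.gram ℝ (Fin.snoc (α := fun _ => EuclideanSpace ℝ (Fin n)) v x) =
      borderedMatrix (Matrix.gram ℝ v) (fun i => inner ℝ (v i) x) (‖x‖ ^ 2) := by
  ext i j
  refine Fin.lastCases ?_ (fun i => ?_) i <;> refine Fin.lastCases ?_ (fun j => ?_) j <;>
    simp [borderedMatrix_castSucc_castSucc, borderedMatrix_castSucc_last,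
      borderedMatrix_last_castSucc, borderedMatrix_last_last, Matrix.gram_apply, real_inner_comm]

theorem measurable_gram (m n : ℕ) :
    Measurable fun v : Fin m → EuclideanSpace ℝ (Fin n) => Matrix.gram ℝ v := by
  refine measurable_pi_lambda _ fun i => measurable_pi_lambda _ fun j => ?_
  simp only [Matrix.gram_apply]
  fun_prop

open Set in
/-- Integration over the last row of a positive definite bordered matrix, in terms of the Schur
complement. -/
theorem lintegral_borderedMatrix {m d : ℕ} {G : Matrix (Fin m) (Fin m) ℝ} (hG : G.PosDef)
    (b : Fin m → ℝ) {F : Matrix (Fin (m + 1)) (Fin (m + 1)) ℝ → ℝ≥0∞} :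
    ∫⁻ c : ℝ, {W : Matrix (Fin (m + 1)) (Fin (m + 1)) ℝ | W.PosDef}.indicator
        (fun W => ENNReal.ofReal (W.det ^ ((d : ℝ) / 2 - 1)) * F W) (borderedMatrix G b c) =
      ENNReal.ofReal (G.det ^ ((d : ℝ) / 2 - 1)) *
        ∫⁻ r in Ioi (0 : ℝ), ENNReal.ofReal (r ^ ((d : ℝ) / 2 - 1)) *
          F (borderedMatrix G b (b ⬝ᵥ G⁻¹.mulVec b + r)) := by
  -- Translating `c` by `bᵀG⁻¹b` makes the new variable the Schur complement `r`; positive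
  -- definiteness becomes `0 < r` and the determinant becomes `|G| r`.
  rw [← lintegral_const_mul' _ _ ENNReal.ofReal_ne_top, ← lintegral_indicator measurableSet_Ioi,
    ← lintegral_add_left_eq_self _ (b ⬝ᵥ G⁻¹.mulVec b)]
  refine lintegral_congr fun r => ?_
  by_cases hr : 0 < r
  · rw [indicator_of_mem (by simpa [borderedMatrix_posDef_iff, hG] using hr),
      indicator_of_mem (by simpa using hr), det_borderedMatrix _ _ hG, add_sub_cancel_left,
      Real.mul_rpow hG.det_pos.le hr.le, ENNReal.ofReal_mul (Real.rpow_nonneg hG.det_pos.le _),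
      mul_assoc]
  · rw [indicator_of_notMem (by simpa [borderedMatrix_posDef_iff, hG] using hr),
      indicator_of_notMem (by simpa using hr)]

/-- Testing the formula with the indicator of the matrices that are not positive definite makes its
right side vanish. The formula is kept as a hypothesis so that `lintegral_gram` can use this on its
own induction hypothesis. -/
theorem ae_posDef_gram_of_lintegral {m n : ℕ} {a : ℝ≥0∞} {f : Matrix (Fin m) (Fin m) ℝ → ℝ≥0∞}
    (h : ∀ F : Matrix (Fin m) (Fin m) ℝ → ℝ≥0∞, Measurable F →
      ∫⁻ v : Fin m → EuclideanSpace ℝ (Fin n), F (Matrix.gram ℝ v) =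
        a * ∫⁻ W, {W : Matrix (Fin m) (Fin m) ℝ | W.PosDef}.indicator (fun W => f W * F W) W
          ∂symmVolume m) :
    ∀ᵐ v : Fin m → EuclideanSpace ℝ (Fin n), (Matrix.gram ℝ v).PosDef := by
  have hm : Measurable ({W : Matrix (Fin m) (Fin m) ℝ | W.PosDef}ᶜ.indicator (1 : Matrix (Fin m) (Fin m) ℝ → ℝ≥0∞)) :=
    measurable_one.indicator (measurableSet_posDef m).compl
  have h1 := h _ hm
  rw [lintegral_congr (f := {W : Matrix (Fin m) (Fin m) ℝ | W.PosDef}.indicator _)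
    (g := fun _ => 0), lintegral_zero, mul_zero] at h1
  · filter_upwards [(lintegral_eq_zero_iff (hm.comp (measurable_gram _ _))).1 h1] with v hv
    by_contra h
    simp [h] at hv
  · intro W
    by_cases hW : W.PosDef <;> simp [hW]

open Set in
/-- The image of Lebesgue measure on `m`-tuples of vectors of `ℝⁿ`, `m ≤ n`, under the Gram matrix
has a density proportional to a power of the determinant. -/
theorem lintegral_gram {m n : ℕ} (hmn : m ≤ n) {F : Matrix (Fin m) (Fin m) ℝ → ℝ≥0∞}
    (hF : Measurable F) :
    ∫⁻ v : Fin m → EuclideanSpace ℝ (Fin n), F (Matrix.gram ℝ v) =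
      ENNReal.ofReal (gramConst m n) * ∫⁻ W, {W : Matrix (Fin m) (Fin m) ℝ | W.PosDef}.indicator
        (fun W => ENNReal.ofReal (W.det ^ (((n : ℝ) - m - 1) / 2)) * F W) W ∂symmVolume m := by
  induction m with
  | zero =>
    have h0 (W : Matrix (Fin 0) (Fin 0) ℝ) : W.PosDef := by
      rw [Subsingleton.elim W 1]; exact Matrix.PosDef.one
    have hF0 (W : Matrix (Fin 0) (Fin 0) ℝ) : F W = F 1 := by rw [Subsingleton.elim W 1]
    -- With no vectors both measures are unit point masses and the constant is `1`.
    rw [symmVolume, lintegral_map _ (measurable_symmOfUpper 0)]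
    · simp [h0, hF0, gramConst, multiGamma, volume_pi]
    · exact (Measurable.mul (by fun_prop) hF).indicator (measurableSet_posDef 0)
  | succ m ih =>
    obtain ⟨d, rfl⟩ : ∃ d, n = m + d := ⟨n - m, by omega⟩
    have hd : 0 < d := by omega
    have ih := fun F hF => ih (F := F) (by omega) hF
    have hae := ae_posDef_gram_of_lintegral ih
    let κ := Real.pi ^ ((d : ℝ) / 2) / Real.Gamma ((d : ℝ) / 2)
    have hκ : 0 ≤ κ := div_nonneg (by positivity) (Real.Gamma_nonneg_of_nonneg (by positivity))
    have hFb : Measurable fun p : Matrix (Fin m) (Fin m) ℝ × (Fin m → ℝ) × ℝ =>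
      F (borderedMatrix p.1 p.2.1 p.2.2) := hF.comp (measurable_borderedMatrix m)
    let H : Matrix (Fin m) (Fin m) ℝ → ℝ≥0∞ := fun G => ∫⁻ b : Fin m → ℝ, ∫⁻ r in Ioi (0 : ℝ),
      ENNReal.ofReal (r ^ ((d : ℝ) / 2 - 1)) * F (borderedMatrix G b (b ⬝ᵥ G⁻¹.mulVec b + r))
    have hHb : Measurable fun p : Matrix (Fin m) (Fin m) ℝ × (Fin m → ℝ) => ∫⁻ r in Ioi (0 : ℝ),
        ENNReal.ofReal (r ^ ((d : ℝ) / 2 - 1)) *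
          F (borderedMatrix p.1 p.2 (p.2 ⬝ᵥ p.1⁻¹.mulVec p.2 + r)) := by
      refine Measurable.lintegral_prod_right' (f := fun q : (Matrix (Fin m) (Fin m) ℝ ×
        (Fin m → ℝ)) × ℝ => ENNReal.ofReal (q.2 ^ ((d : ℝ) / 2 - 1)) *
          F (borderedMatrix q.1.1 q.1.2 (q.1.2 ⬝ᵥ q.1.1⁻¹.mulVec q.1.2 + q.2))) ?_
      refine Measurable.mul (by fun_prop) (hFb.comp (f := fun q : (Matrix (Fin m) (Fin m) ℝ ×
        (Fin m → ℝ)) × ℝ => (q.1.1, q.1.2, q.1.2 ⬝ᵥ q.1.1⁻¹.mulVec q.1.2 + q.2))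
        (measurable_fst.fst.prodMk (measurable_fst.snd.prodMk (Measurable.add ?_ measurable_snd))))
      simp only [dotProduct, Matrix.mulVec]
      refine Finset.measurable_fun_sum _ fun i _ => Measurable.mul (by fun_prop)
        (Finset.measurable_fun_sum _ fun j _ => Measurable.mul ?_ (by fun_prop))
      exact (measurable_pi_apply j).comp ((measurable_pi_apply i).comp
        (measurable_matrix_inv.comp measurable_fst.fst))
    have hH : Measurable H := hHb.lintegral_prod_right'
    have hg : Measurable fun v : Fin (m + 1) → EuclideanSpace ℝ (Fin (m + d)) =>
        F (Matrix.gram ℝ v) := hF.comp (measurable_gram _ _)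
    have hdetm : Measurable fun G : Matrix (Fin m) (Fin m) ℝ => G.det := measurable_det
    calc ∫⁻ v : Fin (m + 1) → EuclideanSpace ℝ (Fin (m + d)), F (Matrix.gram ℝ v)
        = ∫⁻ v : Fin m → EuclideanSpace ℝ (Fin (m + d)), ∫⁻ x : EuclideanSpace ℝ (Fin (m + d)),
            F (borderedMatrix (Matrix.gram ℝ v) (fun i => inner ℝ (v i) x) (‖x‖ ^ 2)) := by
          rw [← ((volume_preserving_piFinSuccAbove
              (fun _ : Fin (m + 1) => EuclideanSpace ℝ (Fin (m + d))) (Fin.last m)).symm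
              _).lintegral_comp hg, Measure.volume_eq_prod, lintegral_prod_symm _
              (by
                exact (hg.comp (MeasurableEquiv.piFinSuccAbove (fun _ : Fin (m + 1) =>
                  EuclideanSpace ℝ (Fin (m + d))) (Fin.last m)).symm.measurable).aemeasurable)]
          refine lintegral_congr fun v => lintegral_congr fun x => ?_
          rw [← gram_snoc, ← Fin.insertNth_last']
          rfl
      _ = ∫⁻ v : Fin m → EuclideanSpace ℝ (Fin (m + d)),
            ENNReal.ofReal (κ * (Matrix.gram ℝ v).det ^ (-(1 / 2) : ℝ)) * H (Matrix.gram ℝ v) := by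
          -- The splitting needs the first `m` vectors to be linearly independent, which holds
          -- almost everywhere by the induction hypothesis.
          refine lintegral_congr_ae ?_
          filter_upwards [hae] with v hv
          exact lintegral_inner_normSq hd rfl v hv
            (g := fun b c => F (borderedMatrix (Matrix.gram ℝ v) b c))
            (hFb.comp measurable_prodMk_left)
      _ = ENNReal.ofReal (gramConst m (m + d)) * ∫⁻ G,
            {G : Matrix (Fin m) (Fin m) ℝ | G.PosDef}.indicator
              (fun G => ENNReal.ofReal (G.det ^ ((((m + d : ℕ) : ℝ) - m - 1) / 2)) *
                (ENNReal.ofReal (κ * G.det ^ (-(1 / 2) : ℝ)) * H G)) G ∂symmVolume m :=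
          ih (fun G => ENNReal.ofReal (κ * G.det ^ (-(1 / 2) : ℝ)) * H G)
            (Measurable.mul (by fun_prop) hH)
      _ = ENNReal.ofReal (gramConst m (m + d)) * ∫⁻ G, (ENNReal.ofReal κ * ∫⁻ b : Fin m → ℝ,
            ∫⁻ c : ℝ, {W : Matrix (Fin (m + 1)) (Fin (m + 1)) ℝ | W.PosDef}.indicator
              (fun W => ENNReal.ofReal (W.det ^ ((d : ℝ) / 2 - 1)) * F W) (borderedMatrix G b c))
              ∂symmVolume m := by
          congr 1
          refine lintegral_congr fun G => ?_
          by_cases hG : G.PosDef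
          · simp only [lintegral_borderedMatrix hG, lintegral_const_mul' _ _ ENNReal.ofReal_ne_top]
            rw [indicator_of_mem (by exact hG), ← mul_assoc, ← mul_assoc,
              ← ENNReal.ofReal_mul (Real.rpow_nonneg hG.det_pos.le _), ← ENNReal.ofReal_mul hκ,
              mul_left_comm, ← Real.rpow_add hG.det_pos]
            -- The exponents of `|G|` add up: `(d-1)/2 - 1/2 = d/2 - 1`, the exponent already
            -- carried by `r`.
            congr 4
            push_cast
            ring
          · rw [indicator_of_notMem (by exact hG)]
            simp [borderedMatrix_posDef_iff, hG]
      _ = _ := by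
          rw [lintegral_symmVolume_succ, lintegral_const_mul' _ _ ENNReal.ofReal_ne_top, ← mul_assoc,
            ← ENNReal.ofReal_mul (gramConst_pos (by omega)).le, gramConst_succ,
            show (((m + d : ℕ) : ℝ) - ((m + 1 : ℕ) : ℝ) - 1) / 2 = (d : ℝ) / 2 - 1 by
              push_cast; ring]
          refine Measurable.indicator ?_ (measurableSet_posDef _)
          exact Measurable.mul (measurable_det.pow_const _).ennreal_ofReal hF

theorem ae_posDef_gram {m n : ℕ} (hmn : m ≤ n) :
    ∀ᵐ v : Fin m → EuclideanSpace ℝ (Fin n), (Matrix.gram ℝ v).PosDef :=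
  ae_posDef_gram_of_lintegral fun _ hF => lintegral_gram hmn hF

/-! ### Scatter matrices and congruences. -/

/-- The scatter matrix of the columns of an `m × n` array is the Gram matrix of its rows, and
transposing the array preserves Lebesgue measure. -/
theorem lintegral_scatterMatrix_eq_gram {m n : ℕ} {F : Matrix (Fin m) (Fin m) ℝ → ℝ≥0∞}
    (hF : Measurable F) :
    ∫⁻ X : Fin n → EuclideanSpace ℝ (Fin m), F (scatterMatrix m n X) =
      ∫⁻ v : Fin m → EuclideanSpace ℝ (Fin n), F (Matrix.gram ℝ v) := by
  have hT := (volume_preserving_pi fun _ : Fin m => PiLp.volume_preserving_toLp (Fin n)).comp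
    ((measurePreserving_swap_pi (Fin n) (Fin m)).comp
      (volume_preserving_pi fun _ : Fin n => PiLp.volume_preserving_ofLp (Fin m)))
  refine (lintegral_congr fun X => congrArg F ?_).trans
    (hT.lintegral_comp (f := fun v => F (Matrix.gram ℝ v)) (hF.comp (measurable_gram m n)))
  ext i j
  simp [scatterMatrix, Matrix.sum_apply, Matrix.vecMulVec_apply, Matrix.gram_apply,
    PiLp.inner_apply, mul_comm]

/-- Integration of a function of the scatter matrix with respect to Lebesgue measure. -/
theorem lintegral_scatterMatrix {m n : ℕ} (hmn : m ≤ n) {F : Matrix (Fin m) (Fin m) ℝ → ℝ≥0∞}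
    (hF : Measurable F) :
    ∫⁻ X : Fin n → EuclideanSpace ℝ (Fin m), F (scatterMatrix m n X) =
      ENNReal.ofReal (gramConst m n) * ∫⁻ W, {W : Matrix (Fin m) (Fin m) ℝ | W.PosDef}.indicator
        (fun W => ENNReal.ofReal (W.det ^ (((n : ℝ) - m - 1) / 2)) * F W) W ∂symmVolume m := by
  rw [lintegral_scatterMatrix_eq_gram hF, lintegral_gram hmn hF]

theorem ae_posDef_scatterMatrix {m n : ℕ} (hmn : m ≤ n) :
    ∀ᵐ X : Fin n → EuclideanSpace ℝ (Fin m), (scatterMatrix m n X).PosDef := by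
  have hm : Measurable ({W : Matrix (Fin m) (Fin m) ℝ | W.PosDef}ᶜ.indicator
      (1 : Matrix (Fin m) (Fin m) ℝ → ℝ≥0∞)) :=
    measurable_one.indicator (measurableSet_posDef m).compl
  have h0 := lintegral_scatterMatrix_eq_gram (n := n) hm
  have h1 := h0.trans ((lintegral_eq_zero_iff (hm.comp (measurable_gram m n))).2 (by
    filter_upwards [ae_posDef_gram hmn] with v hv
    simp [hv]))
  filter_upwards [(lintegral_eq_zero_iff (hm.comp (measurable_scatterMatrix m n))).1 h1] with X hX
  by_contra h
  simp [h] at hX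

theorem pi_smul_const {α : Type*} [MeasurableSpace α] (n : ℕ) (μ : Measure α) [SigmaFinite μ]
    {c : ℝ≥0∞} (hc : c ≠ ∞) :
    Measure.pi (fun _ : Fin n => c • μ) = c ^ n • Measure.pi fun _ : Fin n => μ := by
  have := SigmaFinite.withDensity_of_ne_top (μ := μ) (f := fun _ => c)
    (.of_forall fun _ => hc)
  have h := pi_withDensity n μ (measurable_const (a := c))
  simpa [withDensity_const] using h

theorem map_toEuclideanCLM_volume {m : ℕ} {A : Matrix (Fin m) (Fin m) ℝ} (hA : A.det ≠ 0) :
    Measure.map (Matrix.toEuclideanCLM (𝕜 := ℝ) A) volume = ENNReal.ofReal |A.det⁻¹| • volume := by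
  have hd : LinearMap.det (Matrix.toEuclideanLin A) = A.det := by
    change LinearMap.det (Matrix.toLpLin 2 2 A) = A.det
    rw [Matrix.toLpLin_eq_toLin, LinearMap.det_toLin]
  have := Measure.map_linearMap_addHaar_eq_smul_addHaar
    (volume : Measure (EuclideanSpace ℝ (Fin m))) (f := Matrix.toEuclideanLin A) (by rwa [hd])
  rwa [hd, ← Matrix.coe_toEuclideanCLM_eq_toEuclideanLin] at this

theorem scatterMatrix_toEuclideanCLM {m n : ℕ} (A : Matrix (Fin m) (Fin m) ℝ)
    (X : Fin n → EuclideanSpace ℝ (Fin m)) :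
    scatterMatrix m n (fun k => Matrix.toEuclideanCLM (𝕜 := ℝ) A (X k)) =
      A * scatterMatrix m n X * A.transpose := by
  simp only [scatterMatrix, Matrix.ofLp_toEuclideanCLM, Finset.mul_sum, Finset.sum_mul,
    Matrix.mul_vecMulVec, Matrix.vecMulVec_mul, Matrix.vecMul_transpose]

/-- The behaviour of integrals of functions of the scatter matrix under a congruence. -/
theorem lintegral_scatterMatrix_congruence {m n : ℕ} {A : Matrix (Fin m) (Fin m) ℝ}
    (hA : A.det ≠ 0) {F : Matrix (Fin m) (Fin m) ℝ → ℝ≥0∞} (hF : Measurable F) :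
    ∫⁻ X : Fin n → EuclideanSpace ℝ (Fin m), F (A * scatterMatrix m n X * A.transpose) =
      ENNReal.ofReal (|A.det⁻¹| ^ n) *
        ∫⁻ X : Fin n → EuclideanSpace ℝ (Fin m), F (scatterMatrix m n X) := by
  have hmap : Measure.map (fun (X : Fin n → EuclideanSpace ℝ (Fin m)) k =>
      Matrix.toEuclideanCLM (𝕜 := ℝ) A (X k)) volume = ENNReal.ofReal |A.det⁻¹| ^ n • volume := by
    have hs : SigmaFinite (Measure.map (Matrix.toEuclideanCLM (𝕜 := ℝ) A)
        (volume : Measure (EuclideanSpace ℝ (Fin m)))) := by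
      rw [map_toEuclideanCLM_volume hA, ← withDensity_const]
      exact SigmaFinite.withDensity_of_ne_top
        (.of_forall fun _ => ENNReal.ofReal_ne_top)
    rw [volume_pi, Measure.pi_map_pi fun _ => by fun_prop]
    -- `A` acts on each of the `n` vectors separately, so the one-vector Jacobian occurs to the
    -- power `n`.
    simp only [map_toEuclideanCLM_volume hA]
    exact pi_smul_const n _ ENNReal.ofReal_ne_top
  simp only [← scatterMatrix_toEuclideanCLM]
  rw [← lintegral_map (f := fun X => F (scatterMatrix m n X))
    (g := fun (X : Fin n → EuclideanSpace ℝ (Fin m)) k => Matrix.toEuclideanCLM (𝕜 := ℝ) A (X k))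
    (hF.comp (measurable_scatterMatrix m n)) (by fun_prop), hmap, lintegral_smul_measure,
    smul_eq_mul, ENNReal.ofReal_pow (abs_nonneg _)]

/-! ### Gaussian densities and the Wishart law. -/

theorem stdGaussian_euclideanSpace_eq_withDensity (m : ℕ) :
    stdGaussian (EuclideanSpace ℝ (Fin m)) =
      volume.withDensity fun x => ∏ i, gaussianPDF 0 1 (x i) := by
  have hg : gaussianReal 0 1 = volume.withDensity (gaussianPDF 0 1) :=
    gaussianReal_of_var_ne_zero _ one_ne_zero
  have hs : SigmaFinite ((volume : Measure ℝ).withDensity (gaussianPDF 0 1)) := by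
    rw [← hg]; infer_instance
  rw [← map_pi_eq_stdGaussian, hg, pi_withDensity m _ (measurable_gaussianPDF 0 1)]
  refine Measure.ext_of_lintegral _ fun f hf => ?_
  have hm : Measurable fun x : EuclideanSpace ℝ (Fin m) => ∏ i, gaussianPDF 0 1 (x i) :=
    Finset.measurable_fun_prod _ fun i _ => (measurable_gaussianPDF 0 1).comp (by fun_prop)
  have hm' : Measurable fun x : Fin m → ℝ => ∏ i, gaussianPDF 0 1 (x i) :=
    Finset.measurable_fun_prod _ fun i _ => (measurable_gaussianPDF 0 1).comp (by fun_prop)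
  rw [lintegral_map hf (by fun_prop), lintegral_withDensity_eq_lintegral_mul _ hm (by fun_prop),
    lintegral_withDensity_eq_lintegral_mul _ hm' (by fun_prop),
    ← (PiLp.volume_preserving_toLp (Fin m)).lintegral_comp (hm.mul hf)]
  rfl

/-- The sum of all squared coordinates is the trace of the scatter matrix, so the joint density
depends on the sample only through that matrix. -/
theorem prod_gaussianPDF_eq_scatterMatrix {m n : ℕ} (X : Fin n → EuclideanSpace ℝ (Fin m)) :
    ∏ k, ∏ i, gaussianPDF 0 1 (X k i) =
      ENNReal.ofReal ((2 * Real.pi) ^ (-((m : ℝ) * n / 2)) *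
        Real.exp (-((scatterMatrix m n X).trace / 2))) := by
  have htr : (scatterMatrix m n X).trace = ∑ k, ∑ i, X k i ^ 2 := by
    simp [scatterMatrix, Matrix.trace_sum, Matrix.trace_vecMulVec, dotProduct, sq]
  have hc : (√(2 * Real.pi * (1 : NNReal)))⁻¹ = (2 * Real.pi) ^ (-(1 / 2) : ℝ) := by
    rw [NNReal.coe_one, mul_one, Real.sqrt_eq_rpow, ← Real.rpow_neg (by positivity)]
  have h2 : (0 : ℝ) < 2 * Real.pi := by positivity
  simp only [gaussianPDF]
  rw [Finset.prod_congr rfl fun k _ =>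
    (ENNReal.ofReal_prod_of_nonneg fun i _ => gaussianPDFReal_nonneg 0 1 (X k i)).symm,
    ← ENNReal.ofReal_prod_of_nonneg fun k _ =>
      Finset.prod_nonneg fun i _ => gaussianPDFReal_nonneg 0 1 (X k i)]
  simp only [gaussianPDFReal, hc]
  simp_rw [Finset.prod_mul_distrib, Finset.prod_const, ← Real.exp_sum, htr]
  congr 2
  · simp only [Finset.card_univ, Fintype.card_fin]
    rw [← pow_mul, ← Real.rpow_natCast, ← Real.rpow_mul h2.le]
    congr 1
    push_cast
    ring
  · congr 1
    rw [Finset.sum_div, ← Finset.sum_neg_distrib]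
    refine Finset.sum_congr rfl fun k _ => ?_
    rw [Finset.sum_div, ← Finset.sum_neg_distrib]
    refine Finset.sum_congr rfl fun i _ => ?_
    simp [neg_div]

theorem measurable_trace {m : ℕ} :
    Measurable (Matrix.trace : Matrix (Fin m) (Fin m) ℝ → ℝ) :=
  (Continuous.matrix_trace continuous_id).measurable

theorem sqrt_properties_of_posDef {m : ℕ} {S : Matrix (Fin m) (Fin m) ℝ} (hS : S.PosDef) :
    CFC.sqrt S * CFC.sqrt S = S ∧ (CFC.sqrt S).transpose = CFC.sqrt S ∧
      (CFC.sqrt S).det = S.det ^ (1 / 2 : ℝ) ∧ 0 < (CFC.sqrt S).det := by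
  have h0 : 0 ≤ S := hS.posSemidef.nonneg
  have h1 := CFC.sqrt_mul_sqrt_self S h0
  have hp : (CFC.sqrt S).PosSemidef :=
    Matrix.nonneg_iff_posSemidef.1 (CFC.sqrt_nonneg S)
  have hd : (CFC.sqrt S).det * (CFC.sqrt S).det = S.det := by rw [← Matrix.det_mul, h1]
  have hd' : (CFC.sqrt S).det = S.det ^ (1 / 2 : ℝ) := by
    rw [← Real.sqrt_eq_rpow, ← hd, Real.sqrt_mul_self hp.det_nonneg]
  refine ⟨h1, ?_, hd', hd' ▸ Real.rpow_pos_of_pos hS.det_pos _⟩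
  simpa [Matrix.IsHermitian] using hp.isHermitian

theorem pi_stdGaussian_eq_withDensity (m n : ℕ) :
    (Measure.pi fun _ : Fin n => stdGaussian (EuclideanSpace ℝ (Fin m))) =
      volume.withDensity fun X => ENNReal.ofReal ((2 * Real.pi) ^ (-((m : ℝ) * n / 2)) *
        Real.exp (-((scatterMatrix m n X).trace / 2))) := by
  have hm : Measurable fun x : EuclideanSpace ℝ (Fin m) => ∏ i, gaussianPDF 0 1 (x i) :=
    Finset.measurable_fun_prod _ fun i _ => (measurable_gaussianPDF 0 1).comp (by fun_prop)
  have hs : SigmaFinite ((volume : Measure (EuclideanSpace ℝ (Fin m))).withDensity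
      fun x => ∏ i, gaussianPDF 0 1 (x i)) := by
    rw [← stdGaussian_euclideanSpace_eq_withDensity]; infer_instance
  rw [stdGaussian_euclideanSpace_eq_withDensity, pi_withDensity n _ hm]
  simp only [prod_gaussianPDF_eq_scatterMatrix]
  rfl

/-- The Wishart distribution in terms of Lebesgue measure on `n`-tuples of vectors. -/
theorem lintegral_wishart {m n : ℕ} {S : Matrix (Fin m) (Fin m) ℝ} (hS : S.PosDef)
    {F : Matrix (Fin m) (Fin m) ℝ → ℝ≥0∞} (hF : Measurable F) :
    ∫⁻ W, F W ∂wishart m n S =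
      ENNReal.ofReal ((2 * Real.pi) ^ (-((m : ℝ) * n / 2)) * S.det ^ (-((n : ℝ) / 2))) *
        ∫⁻ X : Fin n → EuclideanSpace ℝ (Fin m),
          ENNReal.ofReal (Real.exp (-((S⁻¹ * scatterMatrix m n X).trace / 2))) *
            F (scatterMatrix m n X) := by
  obtain ⟨hsq, hT, hdet, hpos⟩ := sqrt_properties_of_posDef hS
  set A := CFC.sqrt S
  have hAu : IsUnit A.det := hpos.ne'.isUnit
  have hmap : (Measure.pi fun _ : Fin n => multivariateGaussian 0 S) =
      (Measure.pi fun _ : Fin n => stdGaussian (EuclideanSpace ℝ (Fin m))).map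
        fun X k => Matrix.toEuclideanCLM (𝕜 := ℝ) A (X k) := by
    simp only [multivariateGaussian, zero_add]
    have : IsProbabilityMeasure (Measure.map (Matrix.toEuclideanCLM (𝕜 := ℝ) A)
        (stdGaussian (EuclideanSpace ℝ (Fin m)))) :=
      Measure.isProbabilityMeasure_map (by fun_prop)
    rw [Measure.pi_map_pi fun _ => by fun_prop]
  have hdens : Measurable fun X : Fin n → EuclideanSpace ℝ (Fin m) =>
      ENNReal.ofReal ((2 * Real.pi) ^ (-((m : ℝ) * n / 2)) *
        Real.exp (-((scatterMatrix m n X).trace / 2))) := by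
    have := measurable_trace.comp (measurable_scatterMatrix m n)
    simp only [Function.comp_def] at this
    fun_prop
  have hF' : Measurable fun W : Matrix (Fin m) (Fin m) ℝ =>
      ENNReal.ofReal (Real.exp (-((S⁻¹ * W).trace / 2))) * F W := by
    have := measurable_trace.comp (measurable_matrix_mul (measurable_const (a := S⁻¹))
      (measurable_id (α := Matrix (Fin m) (Fin m) ℝ)))
    simp only [Function.comp_def, id] at this
    exact Measurable.mul (by fun_prop) hF
  have hFA : Measurable fun X : Fin n → EuclideanSpace ℝ (Fin m) =>
      F (A * scatterMatrix m n X * A.transpose) :=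
    hF.comp (measurable_matrix_mul (measurable_matrix_mul measurable_const
      (measurable_scatterMatrix m n)) measurable_const)
  -- With `A = S^(1/2)` the weight `exp(-tr(S⁻¹W)/2)` pulls back to the standard one under `W ↦
  -- AWAᵀ`.
  have htr (W : Matrix (Fin m) (Fin m) ℝ) : (S⁻¹ * (A * W * A.transpose)).trace = W.trace := by
    rw [hT, ← Matrix.mul_assoc, Matrix.trace_mul_comm, ← hsq, Matrix.mul_inv_rev,
      ← Matrix.mul_assoc, ← Matrix.mul_assoc, ← Matrix.mul_assoc, Matrix.mul_nonsing_inv _ hAu,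
      Matrix.one_mul, Matrix.nonsing_inv_mul _ hAu, Matrix.one_mul]
  rw [wishart, lintegral_map hF (measurable_scatterMatrix m n), hmap,
    lintegral_map (f := fun X => F (scatterMatrix m n X))
      (hF.comp (measurable_scatterMatrix m n)) (by fun_prop),
    pi_stdGaussian_eq_withDensity, lintegral_withDensity_eq_lintegral_mul _ hdens]
  · simp only [Pi.mul_apply, scatterMatrix_toEuclideanCLM]
    have key := lintegral_scatterMatrix_congruence (n := n) hpos.ne' hF'
    simp only [htr] at key
    simp only [mul_assoc] at key
    simp only [ENNReal.ofReal_mul (show 0 ≤ (2 * Real.pi) ^ (-((m : ℝ) * n / 2)) by positivity),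
      mul_assoc]
    rw [lintegral_const_mul' _ _ ENNReal.ofReal_ne_top, key]
    congr 3
    rw [hdet, abs_inv, abs_of_pos (Real.rpow_pos_of_pos hS.det_pos _),
      ← Real.rpow_neg hS.det_pos.le, ← Real.rpow_natCast, ← Real.rpow_mul hS.det_pos.le]
    congr 1
    ring
  · simpa only [Function.comp_def, scatterMatrix_toEuclideanCLM] using hFA

instance isProbabilityMeasure_wishart (m n : ℕ) (S : Matrix (Fin m) (Fin m) ℝ) :
    IsProbabilityMeasure (wishart m n S) :=
  Measure.isProbabilityMeasure_map (measurable_scatterMatrix m n).aemeasurable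

/-- The Gaussian sample has a density with respect to Lebesgue measure, so the null set of
`ae_posDef_scatterMatrix` stays null. -/
theorem ae_posDef_wishart {m n : ℕ} (hmn : m ≤ n) {S : Matrix (Fin m) (Fin m) ℝ}
    (hS : S.PosDef) : ∀ᵐ W ∂wishart m n S, W.PosDef := by
  have hm : Measurable ({W : Matrix (Fin m) (Fin m) ℝ | W.PosDef}ᶜ.indicator
      (1 : Matrix (Fin m) (Fin m) ℝ → ℝ≥0∞)) :=
    measurable_one.indicator (measurableSet_posDef m).compl
  have h : ∫⁻ W, {W : Matrix (Fin m) (Fin m) ℝ | W.PosDef}ᶜ.indicator 1 W ∂wishart m n S = 0 := by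
    rw [lintegral_wishart hS hm, lintegral_congr_ae (g := fun _ => 0)]
    · simp
    · filter_upwards [ae_posDef_scatterMatrix hmn] with X hX
      simp [hX]
  filter_upwards [(lintegral_eq_zero_iff hm).1 h] with W hW
  by_contra h
  simp [h] at hW

theorem measurable_ofReal_exp_trace_mul {m : ℕ} {α : Type*} [MeasurableSpace α]
    {f g : α → Matrix (Fin m) (Fin m) ℝ} (hf : Measurable f) (hg : Measurable g) :
    Measurable fun a => ENNReal.ofReal (Real.exp (-((f a * g a).trace / 2))) := by
  have := measurable_trace.comp (measurable_matrix_mul hf hg)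
  simp only [Function.comp_def] at this
  fun_prop

/-! ### Gaussian moments of the determinant. -/

/-- The Gaussian moment of a power of the determinant of the scatter matrix. -/
theorem lintegral_exp_trace_mul_det_rpow {m p q : ℕ} (hq : m ≤ q) :
    ∫⁻ X : Fin q → EuclideanSpace ℝ (Fin m),
        ENNReal.ofReal (Real.exp (-((scatterMatrix m q X).trace / 2))) *
          ENNReal.ofReal ((scatterMatrix m q X).det ^ ((p : ℝ) / 2)) =
      ENNReal.ofReal (gramConst m q / gramConst m (p + q) *
        (2 * Real.pi) ^ ((m : ℝ) * (p + q) / 2)) := by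
  have hexp : Measurable fun W : Matrix (Fin m) (Fin m) ℝ =>
      ENNReal.ofReal (Real.exp (-(W.trace / 2))) := by
    have : Measurable fun W : Matrix (Fin m) (Fin m) ℝ => W.trace := measurable_trace
    fun_prop
  have hdet : Measurable fun W : Matrix (Fin m) (Fin m) ℝ =>
      ENNReal.ofReal (W.det ^ ((p : ℝ) / 2)) := by
    have : Measurable fun W : Matrix (Fin m) (Fin m) ℝ => W.det := measurable_det
    fun_prop
  -- The total mass one of the standard Wishart law with `p + q` degrees of freedom evaluates the
  -- integral `I` below.
  have h1 := lintegral_wishart (m := m) (n := p + q) (S := 1) Matrix.PosDef.one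
    (F := fun _ => 1) measurable_const
  simp only [lintegral_const, measure_univ, mul_one, inv_one, one_mul, Matrix.det_one,
    Real.one_rpow] at h1
  rw [lintegral_scatterMatrix (by omega) hexp] at h1
  refine (lintegral_scatterMatrix hq (hexp.mul hdet)).trans ?_
  set I := ∫⁻ W, {W : Matrix (Fin m) (Fin m) ℝ | W.PosDef}.indicator
    (fun W => ENNReal.ofReal (W.det ^ ((((p + q : ℕ) : ℝ) - m - 1) / 2)) *
      ENNReal.ofReal (Real.exp (-(W.trace / 2)))) W ∂symmVolume m with hI
  -- The factor `|W|^(p/2)` raises the degrees of freedom in the exponent from `q` to `p + q`.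
  have h2 : ∫⁻ W, {W : Matrix (Fin m) (Fin m) ℝ | W.PosDef}.indicator
      (fun W => ENNReal.ofReal (W.det ^ (((q : ℝ) - m - 1) / 2)) *
        (ENNReal.ofReal (Real.exp (-(W.trace / 2))) *
          ENNReal.ofReal (W.det ^ ((p : ℝ) / 2)))) W ∂symmVolume m = I := by
    refine lintegral_congr fun W => ?_
    by_cases hW : W.PosDef
    · simp only [Set.indicator_of_mem (show W ∈ {W : Matrix (Fin m) (Fin m) ℝ | W.PosDef} from hW)]
      rw [mul_left_comm, mul_comm, ← ENNReal.ofReal_mul (Real.rpow_nonneg hW.det_pos.le _),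
        ← Real.rpow_add hW.det_pos]
      congr 4
      push_cast
      ring
    · simp [hW]
  have hpos := gramConst_pos (m := m) (n := p + q) (by omega)
  have hc : 0 < (2 * Real.pi) ^ ((m : ℝ) * (p + q) / 2) := by positivity
  have hI' : I = ENNReal.ofReal ((gramConst m (p + q))⁻¹ *
      (2 * Real.pi) ^ ((m : ℝ) * (p + q) / 2)) := by
    rw [← mul_assoc, ← ENNReal.ofReal_mul (by positivity)] at h1
    rw [mul_comm] at h1
    rw [ENNReal.eq_inv_of_mul_eq_one_left h1.symm, ← ENNReal.ofReal_inv_of_pos (by positivity)]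
    congr 1
    rw [Real.rpow_neg (by positivity), mul_inv, inv_inv, mul_comm]
    push_cast
    rfl
  exact (congrArg _ (h2.trans hI')).trans (by
    rw [← ENNReal.ofReal_mul (gramConst_pos hq).le, ← mul_assoc, ← div_eq_mul_inv])

/-- The same moment for a Gaussian weight with precision matrix `Q`. -/
theorem lintegral_exp_trace_mul_mul_det_rpow {m p q : ℕ} (hq : m ≤ q)
    {Q : Matrix (Fin m) (Fin m) ℝ} (hQ : Q.PosDef) :
    ∫⁻ X : Fin q → EuclideanSpace ℝ (Fin m),
        ENNReal.ofReal (Real.exp (-((Q * scatterMatrix m q X).trace / 2))) *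
          ENNReal.ofReal ((scatterMatrix m q X).det ^ ((p : ℝ) / 2)) =
      ENNReal.ofReal (Q.det ^ (-(((p : ℝ) + q) / 2)) * (gramConst m q / gramConst m (p + q) *
        (2 * Real.pi) ^ ((m : ℝ) * (p + q) / 2))) := by
  obtain ⟨hsq, hT, hdet, hpos⟩ := sqrt_properties_of_posDef hQ
  set R := CFC.sqrt Q
  have hF : Measurable fun W : Matrix (Fin m) (Fin m) ℝ =>
      ENNReal.ofReal (Real.exp (-(W.trace / 2))) * ENNReal.ofReal (W.det ^ ((p : ℝ) / 2)) := by
    have h1 : Measurable fun W : Matrix (Fin m) (Fin m) ℝ => W.trace := measurable_trace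
    have h2 : Measurable fun W : Matrix (Fin m) (Fin m) ℝ => W.det := measurable_det
    fun_prop
  have key := lintegral_scatterMatrix_congruence (n := q) hpos.ne' hF
  rw [lintegral_exp_trace_mul_det_rpow hq] at key
  -- Substituting `W ↦ RWRᵀ` with `R = Q^(1/2)`: the determinant contributes `|Q|^(-p/2)` here and
  -- the Jacobian `|Q|^(-q/2)` below.
  have hcongr : ∀ᵐ X : Fin q → EuclideanSpace ℝ (Fin m),
      ENNReal.ofReal (Real.exp (-((Q * scatterMatrix m q X).trace / 2))) *
          ENNReal.ofReal ((scatterMatrix m q X).det ^ ((p : ℝ) / 2)) =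
        ENNReal.ofReal (Q.det ^ (-((p : ℝ) / 2))) *
          (ENNReal.ofReal (Real.exp (-((R * scatterMatrix m q X * R.transpose).trace / 2))) *
            ENNReal.ofReal ((R * scatterMatrix m q X * R.transpose).det ^ ((p : ℝ) / 2))) := by
    filter_upwards [ae_posDef_scatterMatrix hq] with X hX
    have htr : (R * scatterMatrix m q X * R.transpose).trace = (Q * scatterMatrix m q X).trace := by
      rw [hT, Matrix.trace_mul_comm, ← Matrix.mul_assoc, hsq]
    have hdt : (R * scatterMatrix m q X * R.transpose).det = Q.det * (scatterMatrix m q X).det := by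
      rw [Matrix.det_mul, Matrix.det_mul, hT, mul_right_comm, ← Matrix.det_mul, hsq]
    rw [htr, hdt, mul_left_comm, ← ENNReal.ofReal_mul (Real.rpow_nonneg hQ.det_pos.le _),
      Real.mul_rpow hQ.det_pos.le hX.det_pos.le, ← mul_assoc, ← Real.rpow_add hQ.det_pos,
      neg_add_cancel, Real.rpow_zero, one_mul]
  rw [lintegral_congr_ae hcongr, lintegral_const_mul' _ _ ENNReal.ofReal_ne_top, key,
    ← ENNReal.ofReal_mul (by positivity), ← ENNReal.ofReal_mul (Real.rpow_nonneg hQ.det_pos.le _),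
    ← mul_assoc]
  congr 2
  rw [hdet, abs_inv, abs_of_pos (Real.rpow_pos_of_pos hQ.det_pos _),
    ← Real.rpow_neg hQ.det_pos.le, ← Real.rpow_natCast, ← Real.rpow_mul hQ.det_pos.le,
    ← Real.rpow_add hQ.det_pos]
  congr 1
  ring

/-! ### The ratio of two Wishart matrices. -/

/-- Congruence of a standard Wishart matrix by the inverse square root of `W`. -/
theorem lintegral_wishart_one_congruence {m n : ℕ} {W : Matrix (Fin m) (Fin m) ℝ} (hW : W.PosDef)
    {F : Matrix (Fin m) (Fin m) ℝ → ℝ≥0∞} (hF : Measurable F) :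
    ∫⁻ V, F ((CFC.sqrt W)⁻¹ * V * (CFC.sqrt W)⁻¹) ∂wishart m n 1 =
      ENNReal.ofReal ((2 * Real.pi) ^ (-((m : ℝ) * n / 2))) *
        (ENNReal.ofReal (W.det ^ ((n : ℝ) / 2)) * ∫⁻ X : Fin n → EuclideanSpace ℝ (Fin m),
          ENNReal.ofReal (Real.exp (-((W * scatterMatrix m n X).trace / 2))) *
            F (scatterMatrix m n X)) := by
  obtain ⟨hsq, hT, hdet, hpos⟩ := sqrt_properties_of_posDef hW
  set B := CFC.sqrt W
  have hBu : IsUnit B.det := hpos.ne'.isUnit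
  have hBi : B⁻¹.det = B.det⁻¹ := by rw [Matrix.det_nonsing_inv, Ring.inverse_eq_inv']
  have hBT : B⁻¹.transpose = B⁻¹ := by rw [Matrix.transpose_nonsing_inv, hT]
  have hm : Measurable fun V : Matrix (Fin m) (Fin m) ℝ => F (B⁻¹ * V * B⁻¹) :=
    hF.comp (measurable_matrix_mul (measurable_matrix_mul measurable_const measurable_id)
      measurable_const)
  have hF' : Measurable fun V : Matrix (Fin m) (Fin m) ℝ =>
      ENNReal.ofReal (Real.exp (-((W * V).trace / 2))) * F V :=
    (measurable_ofReal_exp_trace_mul measurable_const measurable_id).mul hF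
  have key := lintegral_scatterMatrix_congruence (n := n) (A := B⁻¹)
    (by rw [hBi]; exact inv_ne_zero hpos.ne') hF'
  -- The weight `exp(-tr(WV)/2)` is chosen so that the congruence by `W^(-1/2)` turns it into the
  -- standard one.
  have htr (V : Matrix (Fin m) (Fin m) ℝ) : (W * (B⁻¹ * V * B⁻¹)).trace = V.trace := by
    rw [← Matrix.mul_assoc, Matrix.trace_mul_comm, ← hsq, ← Matrix.mul_assoc, ← Matrix.mul_assoc,
      ← Matrix.mul_assoc, Matrix.nonsing_inv_mul _ hBu, Matrix.one_mul,
      Matrix.mul_nonsing_inv _ hBu, Matrix.one_mul]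
  rw [lintegral_wishart Matrix.PosDef.one hm]
  simp only [hBT, htr] at key
  simp only [inv_one, one_mul, Matrix.det_one, Real.one_rpow, mul_one]
  rw [key, hBi, inv_inv, abs_of_pos hpos, hdet, ← Real.rpow_natCast,
    ← Real.rpow_mul hW.det_pos.le]
  congr 4
  ring

/-- The exponents of `π` in `gramConst` are additive in the degrees of freedom, so only the gamma
factors survive. -/
theorem gramConst_mul_div {m p q : ℕ} (hp : m ≤ p) (hq : m ≤ q) :
    gramConst m p * gramConst m q / gramConst m (p + q) =
      multiGamma m (((p : ℝ) + q) / 2) /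
        (multiGamma m ((p : ℝ) / 2) * multiGamma m ((q : ℝ) / 2)) := by
  have h1 := (multiGamma_natCast_pos hp).ne'
  have h2 := (multiGamma_natCast_pos hq).ne'
  have h3 := (multiGamma_natCast_pos (show m ≤ p + q by omega)).ne'
  push_cast at h3
  simp only [gramConst]
  push_cast
  rw [show (m : ℝ) * (p + q) / 2 = m * p / 2 + m * q / 2 by ring, Real.rpow_add Real.pi_pos]
  have h4 : Real.pi ^ ((m : ℝ) * p / 2) ≠ 0 := by positivity
  have h5 : Real.pi ^ ((m : ℝ) * q / 2) ≠ 0 := by positivity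
  field_simp

theorem det_inv_add {m : ℕ} {S U : Matrix (Fin m) (Fin m) ℝ} (hS : S.PosDef) :
    (S⁻¹ + U).det = S.det⁻¹ * (1 + S * U).det := by
  have hu : IsUnit S.det := hS.det_pos.ne'.isUnit
  have : S⁻¹ + U = S⁻¹ * (1 + S * U) := by
    rw [Matrix.mul_add, Matrix.mul_one, ← Matrix.mul_assoc, Matrix.nonsing_inv_mul _ hu,
      Matrix.one_mul]
  rw [this, Matrix.det_mul, Matrix.det_nonsing_inv, Ring.inverse_eq_inv']

/-- The density of the matrix-variate beta distribution of the second kind. -/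
theorem betaDensity_eq {m p q : ℕ} (hp : m ≤ p) (hq : m ≤ q)
    {S U : Matrix (Fin m) (Fin m) ℝ} (hS : S.PosDef) (hU : U.PosDef) :
    (2 * Real.pi) ^ (-((m : ℝ) * q / 2)) * S.det ^ (-((q : ℝ) / 2)) *
        (2 * Real.pi) ^ (-((m : ℝ) * p / 2)) * gramConst m p *
        ((S⁻¹ + U).det ^ (-(((p : ℝ) + q) / 2)) * (gramConst m q / gramConst m (p + q) *
          (2 * Real.pi) ^ ((m : ℝ) * (p + q) / 2))) * U.det ^ (((p : ℝ) - m - 1) / 2) =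
      multiGamma m (((p : ℝ) + q) / 2) * S.det ^ ((p : ℝ) / 2) /
          (multiGamma m ((p : ℝ) / 2) * multiGamma m ((q : ℝ) / 2)) *
        (1 + S * U).det ^ (-(((p : ℝ) + q) / 2)) * U.det ^ (((p : ℝ) - m - 1) / 2) := by
  have hQ : 0 < (S⁻¹ + U).det := (hS.inv.add hU).det_pos
  have h1 : (1 + S * U).det = S.det * (S⁻¹ + U).det := by
    rw [det_inv_add hS, mul_inv_cancel_left₀ hS.det_pos.ne']
  have h2 : (2 * Real.pi) ^ ((m : ℝ) * (p + q) / 2) * ((2 * Real.pi) ^ (-((m : ℝ) * p / 2)) *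
      (2 * Real.pi) ^ (-((m : ℝ) * q / 2))) = 1 := by
    rw [← Real.rpow_add (by positivity), ← Real.rpow_add (by positivity),
      show (m : ℝ) * (p + q) / 2 + (-(m * p / 2) + -(m * q / 2)) = 0 by ring, Real.rpow_zero]
  have h3 : S.det ^ ((p : ℝ) / 2) * S.det ^ (-(((p : ℝ) + q) / 2)) = S.det ^ (-((q : ℝ) / 2)) := by
    rw [← Real.rpow_add hS.det_pos]
    congr 1
    ring
  rw [h1, Real.mul_rpow hS.det_pos.le hQ.le, mul_div_right_comm (multiGamma m _),
    ← gramConst_mul_div hp hq, ← h3]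
  -- After the rewrites the two sides differ only by the powers of `2π`, whose product is `1` by
  -- `h2`.
  linear_combination (gramConst m p * gramConst m q / gramConst m (p + q) *
    (S.det ^ ((p : ℝ) / 2) * S.det ^ (-(((p : ℝ) + q) / 2))) *
    (S⁻¹ + U).det ^ (-(((p : ℝ) + q) / 2)) * U.det ^ (((p : ℝ) - m - 1) / 2)) * h2

theorem lintegral_wishart_ratio {m p q : ℕ} (hp : m ≤ p) (hq : m ≤ q)
    {S : Matrix (Fin m) (Fin m) ℝ} (hS : S.PosDef) {F : Matrix (Fin m) (Fin m) ℝ → ℝ≥0∞}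
    (hF : Measurable F) :
    ∫⁻ W, ∫⁻ V, F ((CFC.sqrt W)⁻¹ * V * (CFC.sqrt W)⁻¹) ∂wishart m p 1 ∂wishart m q S =
      ∫⁻ U, {U : Matrix (Fin m) (Fin m) ℝ | U.PosDef}.indicator (fun U =>
          ENNReal.ofReal
            (multiGamma m (((p : ℝ) + q) / 2) * S.det ^ ((p : ℝ) / 2) /
                (multiGamma m ((p : ℝ) / 2) * multiGamma m ((q : ℝ) / 2)) *
              (1 + S * U).det ^ (-(((p : ℝ) + q) / 2)) *
              U.det ^ (((p : ℝ) - m - 1) / 2))) U * F U ∂symmVolume m := by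
  have hsc (n : ℕ) := measurable_scatterMatrix m n
  have hdet : Measurable fun W : Matrix (Fin m) (Fin m) ℝ =>
      ENNReal.ofReal (W.det ^ ((p : ℝ) / 2)) := (measurable_det.pow_const _).ennreal_ofReal
  have hexp : Measurable fun W : Matrix (Fin m) (Fin m) ℝ =>
      ENNReal.ofReal (Real.exp (-((S⁻¹ * W).trace / 2))) :=
    measurable_ofReal_exp_trace_mul measurable_const measurable_id
  let c₁ := (2 * Real.pi) ^ (-((m : ℝ) * p / 2))
  let c₂ := (2 * Real.pi) ^ (-((m : ℝ) * q / 2)) * S.det ^ (-((q : ℝ) / 2))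
  let K := gramConst m q / gramConst m (p + q) * (2 * Real.pi) ^ ((m : ℝ) * (p + q) / 2)
  have hc₁ : 0 ≤ c₁ := by positivity
  have hc₂ : 0 ≤ c₂ := mul_nonneg (by positivity) (Real.rpow_nonneg hS.det_pos.le _)
  have hK : 0 ≤ K := mul_nonneg (div_nonneg (gramConst_pos hq).le
    (gramConst_pos (show m ≤ p + q by omega)).le) (by positivity)
  let g : Matrix (Fin m) (Fin m) ℝ → (Fin p → EuclideanSpace ℝ (Fin m)) → ℝ≥0∞ := fun W X =>
    ENNReal.ofReal (Real.exp (-((W * scatterMatrix m p X).trace / 2))) * F (scatterMatrix m p X)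
  have hg : Measurable (Function.uncurry g) :=
    (measurable_ofReal_exp_trace_mul measurable_fst ((hsc p).comp measurable_snd)).mul
      (hF.comp ((hsc p).comp measurable_snd))
  have hgW : Measurable fun W => ∫⁻ X, g W X := hg.lintegral_prod_right'
  calc ∫⁻ W, ∫⁻ V, F ((CFC.sqrt W)⁻¹ * V * (CFC.sqrt W)⁻¹) ∂wishart m p 1 ∂wishart m q S
      = ∫⁻ W, ENNReal.ofReal c₁ * (ENNReal.ofReal (W.det ^ ((p : ℝ) / 2)) * ∫⁻ X, g W X)
          ∂wishart m q S := by
        refine lintegral_congr_ae ?_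
        -- Only for positive definite `W` does `CFC.sqrt W` have the required properties, and this
        -- is almost every `W`.
        filter_upwards [ae_posDef_wishart hq hS] with W hW
        exact lintegral_wishart_one_congruence hW hF
    _ = ENNReal.ofReal c₁ * (ENNReal.ofReal c₂ * ∫⁻ Y : Fin q → EuclideanSpace ℝ (Fin m),
          ENNReal.ofReal (Real.exp (-((S⁻¹ * scatterMatrix m q Y).trace / 2))) *
            (ENNReal.ofReal ((scatterMatrix m q Y).det ^ ((p : ℝ) / 2)) *
              ∫⁻ X, g (scatterMatrix m q Y) X)) := by
        rw [lintegral_const_mul' _ _ ENNReal.ofReal_ne_top]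
        refine congrArg _ ?_
        exact lintegral_wishart hS (F := fun W => ENNReal.ofReal (W.det ^ ((p : ℝ) / 2)) *
          ∫⁻ X, g W X) ((measurable_det.pow_const _).ennreal_ofReal.mul hgW)
    _ = ENNReal.ofReal c₁ * (ENNReal.ofReal c₂ * ∫⁻ X : Fin p → EuclideanSpace ℝ (Fin m),
          F (scatterMatrix m p X) * ∫⁻ Y : Fin q → EuclideanSpace ℝ (Fin m),
            ENNReal.ofReal (Real.exp (-(((S⁻¹ + scatterMatrix m p X) *
              scatterMatrix m q Y).trace / 2))) *
                ENNReal.ofReal ((scatterMatrix m q Y).det ^ ((p : ℝ) / 2))) := by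
        congr 2
        have h1 : Measurable fun z : (Fin q → EuclideanSpace ℝ (Fin m)) ×
            (Fin p → EuclideanSpace ℝ (Fin m)) =>
            ENNReal.ofReal (Real.exp (-((S⁻¹ * scatterMatrix m q z.1).trace / 2))) *
              (ENNReal.ofReal ((scatterMatrix m q z.1).det ^ ((p : ℝ) / 2)) *
                g (scatterMatrix m q z.1) z.2) := by
          have h2 : Measurable fun z : Matrix (Fin m) (Fin m) ℝ ×
              (Fin p → EuclideanSpace ℝ (Fin m)) =>
              ENNReal.ofReal (Real.exp (-((S⁻¹ * z.1).trace / 2))) *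
                (ENNReal.ofReal (z.1.det ^ ((p : ℝ) / 2)) * Function.uncurry g z) :=
            (hexp.comp measurable_fst).mul ((hdet.comp measurable_fst).mul hg)
          exact h2.comp (f := fun z : (Fin q → EuclideanSpace ℝ (Fin m)) ×
            (Fin p → EuclideanSpace ℝ (Fin m)) => (scatterMatrix m q z.1, z.2))
            (((hsc q).comp measurable_fst).prodMk measurable_snd)
        -- Tonelli: the sample `Y` behind `W₂` is integrated first, with the sample `X` behind `U`
        -- fixed. As the trace is symmetric in the two scatter matrices, the exponentials merge into
        -- one with precision `S⁻¹ + U`.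
        simp only [← lintegral_const_mul' _ _ ENNReal.ofReal_ne_top]
        rw [lintegral_lintegral_swap h1.aemeasurable]
        refine lintegral_congr fun X => ?_
        rw [← lintegral_const_mul]
        · refine lintegral_congr fun Y => ?_
          simp only [g]
          rw [Matrix.add_mul, Matrix.trace_add, add_div, neg_add, Real.exp_add,
            ENNReal.ofReal_mul (Real.exp_pos _).le,
            Matrix.trace_mul_comm (scatterMatrix m p X)]
          ring
        · exact (measurable_ofReal_exp_trace_mul measurable_const (hsc q)).mul (hdet.comp (hsc q))
    _ = ENNReal.ofReal c₁ * (ENNReal.ofReal c₂ * ∫⁻ X : Fin p → EuclideanSpace ℝ (Fin m),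
          F (scatterMatrix m p X) * ENNReal.ofReal
            ((S⁻¹ + scatterMatrix m p X).det ^ (-(((p : ℝ) + q) / 2)) * K)) := by
        congr 2
        refine lintegral_congr_ae ?_
        filter_upwards [ae_posDef_scatterMatrix hp] with X hX
        rw [lintegral_exp_trace_mul_mul_det_rpow hq (hS.inv.add hX)]
    _ = _ := by
        -- The integrand now depends on `X` only through its scatter matrix, so the integral passes
        -- to `symmVolume` and brings in `|U|^((p-m-1)/2)`.
        rw [lintegral_scatterMatrix hp (F := fun U => F U * ENNReal.ofReal
            ((S⁻¹ + U).det ^ (-(((p : ℝ) + q) / 2)) * K)),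
          ← lintegral_const_mul' _ _ ENNReal.ofReal_ne_top,
          ← lintegral_const_mul' _ _ ENNReal.ofReal_ne_top,
          ← lintegral_const_mul' _ _ ENNReal.ofReal_ne_top]
        · refine lintegral_congr fun U => ?_
          by_cases hU : U.PosDef
          · have hmem : U ∈ {U : Matrix (Fin m) (Fin m) ℝ | U.PosDef} := hU
            have hQ := (hS.inv.add hU).det_pos.le
            rw [Set.indicator_of_mem hmem, Set.indicator_of_mem hmem, ← betaDensity_eq hp hq hS hU,
              ENNReal.ofReal_mul (mul_nonneg (mul_nonneg (mul_nonneg hc₂ hc₁) (gramConst_pos hp).le)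
                (mul_nonneg (Real.rpow_nonneg hQ _) hK)),
              ENNReal.ofReal_mul (mul_nonneg (mul_nonneg hc₂ hc₁) (gramConst_pos hp).le),
              ENNReal.ofReal_mul (mul_nonneg hc₂ hc₁), ENNReal.ofReal_mul hc₂]
            ring
          · simp [hU]
        · refine hF.mul ?_
          have : Measurable fun U : Matrix (Fin m) (Fin m) ℝ => (S⁻¹ + U).det :=
            (Continuous.matrix_det (by fun_prop)).measurable
          fun_prop

/-! ### From integrals to the law of `U`. -/

/-- Independence makes the joint law a product, and a measure is determined by its integrals of
nonnegative measurable functions. The variable `Y` is integrated last, matching the conditioning on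
`W₂`. -/
theorem hasLaw_of_indepFun_of_lintegral {Ω α β γ : Type*} [MeasurableSpace Ω] [MeasurableSpace α]
    [MeasurableSpace β] [MeasurableSpace γ] {P : Measure Ω} [IsProbabilityMeasure P]
    {X : Ω → α} {Y : Ω → β} {μ : Measure α} {ν : Measure β} [SFinite μ] [SFinite ν]
    (hX : HasLaw X μ P) (hY : HasLaw Y ν P) (hind : IndepFun X Y P) {Φ : α × β → γ}
    (hΦ : Measurable Φ) {ρ : Measure γ}
    (h : ∀ F : γ → ℝ≥0∞, Measurable F → ∫⁻ y, ∫⁻ x, F (Φ (x, y)) ∂μ ∂ν = ∫⁻ z, F z ∂ρ) :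
    HasLaw (fun ω => Φ (X ω, Y ω)) ρ P := by
  have hpair : AEMeasurable (fun ω => (X ω, Y ω)) P := hX.aemeasurable.prodMk hY.aemeasurable
  have hjoint : P.map (fun ω => (X ω, Y ω)) = μ.prod ν := by
    rw [(indepFun_iff_map_prod_eq_prod_map_map hX.aemeasurable hY.aemeasurable).1 hind,
      hX.map_eq, hY.map_eq]
  refine ⟨hΦ.comp_aemeasurable hpair, Measure.ext_of_lintegral _ fun F hF => ?_⟩
  have hmap : P.map (fun ω => Φ (X ω, Y ω)) = (μ.prod ν).map Φ := by
    rw [← hjoint, AEMeasurable.map_map_of_aemeasurable hΦ.aemeasurable hpair]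
    rfl
  rw [hmap, lintegral_map hF hΦ, lintegral_prod_symm _ (by exact (hF.comp hΦ).aemeasurable),
    h F hF]

theorem theorem1 (m n₁ n₂ : ℕ) (hn₁ : m ≤ n₁) (hn₂ : m ≤ n₂)
    (S₂ : Matrix (Fin m) (Fin m) ℝ) (hS₂ : S₂.PosDef)
    {Ω : Type*} [MeasurableSpace Ω] (P : Measure Ω) [IsProbabilityMeasure P]
    (W₁ W₂ : Ω → Matrix (Fin m) (Fin m) ℝ)
    (hW₁ : HasLaw W₁ (wishart m n₁ 1) P) (hW₂ : HasLaw W₂ (wishart m n₂ S₂) P)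
    (hind : IndepFun W₁ W₂ P) :
    HasLaw (fun ω => (CFC.sqrt (W₂ ω))⁻¹ * W₁ ω * (CFC.sqrt (W₂ ω))⁻¹)
      ((symmVolume m).withDensity
        (Set.indicator {U : Matrix (Fin m) (Fin m) ℝ | U.PosDef} fun U =>
          ENNReal.ofReal
            (multiGamma m (((n₁ : ℝ) + n₂) / 2) * S₂.det ^ ((n₁ : ℝ) / 2) /
                (multiGamma m ((n₁ : ℝ) / 2) * multiGamma m ((n₂ : ℝ) / 2)) *
              (1 + S₂ * U).det ^ (-(((n₁ : ℝ) + n₂) / 2)) *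
              U.det ^ (((n₁ : ℝ) - m - 1) / 2)))) P := by
  have hΦ : Measurable fun z : Matrix (Fin m) (Fin m) ℝ × Matrix (Fin m) (Fin m) ℝ =>
      (CFC.sqrt z.2)⁻¹ * z.1 * (CFC.sqrt z.2)⁻¹ := by
    have hs : Measurable fun z : Matrix (Fin m) (Fin m) ℝ × Matrix (Fin m) (Fin m) ℝ =>
        (CFC.sqrt z.2)⁻¹ :=
      measurable_matrix_inv.comp ((measurable_matrix_sqrt m).comp measurable_snd)
    exact measurable_matrix_mul (measurable_matrix_mul hs measurable_fst) hs
  have hdens : Measurable (Set.indicator {U : Matrix (Fin m) (Fin m) ℝ | U.PosDef} fun U =>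
      ENNReal.ofReal
        (multiGamma m (((n₁ : ℝ) + n₂) / 2) * S₂.det ^ ((n₁ : ℝ) / 2) /
            (multiGamma m ((n₁ : ℝ) / 2) * multiGamma m ((n₂ : ℝ) / 2)) *
          (1 + S₂ * U).det ^ (-(((n₁ : ℝ) + n₂) / 2)) *
          U.det ^ (((n₁ : ℝ) - m - 1) / 2))) := by
    refine Measurable.indicator ?_ (measurableSet_posDef m)
    have h1 : Measurable fun U : Matrix (Fin m) (Fin m) ℝ => (1 + S₂ * U).det :=
      (Continuous.matrix_det (by fun_prop)).measurable
    have h2 : Measurable fun U : Matrix (Fin m) (Fin m) ℝ => U.det := measurable_det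
    fun_prop
  refine hasLaw_of_indepFun_of_lintegral hW₁ hW₂ hind hΦ fun F hF => ?_
  rw [lintegral_withDensity_eq_lintegral_mul _ hdens hF]
  exact lintegral_wishart_ratio hn₁ hn₂ hS₂ hF
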